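/- Let $n\ge 1$ and $d\ge 0$ be integers and let $f\in\mathbb{R}[x_1,\dots,x_n]$ be a form (homogeneous polynomial) of degree $d$ with Hessian matrix $H_f(x)=\left(\frac{\partial^2 f}{\partial x_i\partial x_j}(x)\right)_{i,j}$. Let $S^{n-1}$ be the Euclidean unit sphere of $\mathbb{R}^n$, suppose that $y^TH_f(x)y>0$ for all $(x,y)\in S^{n-1}\times S^{n-1}$, and put $$\eta(f):=\frac{\min\{y^TH_f(x)y \mid (x,y)\in S^{n-1}\times S^{n-1}\}}{\max\{y^TH_f(x)y \mid (x,y)\in S^{n-1}\times S^{n-1}\}}.$$ If $r$ is a nonnegative integer with $$r\ \ge\ \frac{n(d-2)(d-3)}{4\log(2)\,\eta(f)}-\frac{n+d-2}{2}-d,$$ where $\log$ is the natural logarithm, then $f$ is $r$-sos-convex, that is, the polynomial $y^TH_f(x)y\cdot\left(\sum_{i=1}^n x_i^2\right)^r$ in the $2n$ variables $(x,y)$ is a finite sum of squares of polynomials in $\mathbb{R}[x_1,\dots,x_n,y_1,\dots,y_n]$. -/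

import Mathlib

open MvPolynomial

noncomputable section

/-- The Hessian matrix `H_f` of a polynomial `f` in `n` variables, with polynomial entries. -/
def polyHessian {n : ℕ} (f : MvPolynomial (Fin n) ℝ) :
    Matrix (Fin n) (Fin n) (MvPolynomial (Fin n) ℝ) :=
  Matrix.of fun i j => pderiv i (pderiv j f)

/-- The polynomial `yᵀ H_f(x) y` in the `2n` variables `(x, y)`: the variables `x` are indexed by
the left summand of `Fin n ⊕ Fin n` and the variables `y` by the right summand. -/
def hessianBiform {n : ℕ} (f : MvPolynomial (Fin n) ℝ) : MvPolynomial (Fin n ⊕ Fin n) ℝ :=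
  ∑ i, ∑ j, X (Sum.inr i) * rename Sum.inl (polyHessian f i j) * X (Sum.inr j)

/-- The real number `yᵀ H_f(x) y` at points `x` and `y` of Euclidean `n`-space. -/
def hessianBiformAt {n : ℕ} (f : MvPolynomial (Fin n) ℝ) (x y : EuclideanSpace ℝ (Fin n)) : ℝ :=
  eval (Sum.elim x.ofLp y.ofLp) (hessianBiform f)

/-- The set of values of `yᵀ H_f(x) y` on the bisphere `S^{n-1} × S^{n-1}`. -/
def bisphereValues {n : ℕ} (f : MvPolynomial (Fin n) ℝ) : Set ℝ :=
  {v | ∃ x ∈ Metric.sphere (0 : EuclideanSpace ℝ (Fin n)) 1,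
    ∃ y ∈ Metric.sphere (0 : EuclideanSpace ℝ (Fin n)) 1, hessianBiformAt f x y = v}

/-- `η(f)`: the minimum of `yᵀ H_f(x) y` on the bisphere divided by its maximum. For `1 ≤ n` both
are attained: see `isLeast_bisphereValues` and `isGreatest_bisphereValues`. -/
def bisphereRatio {n : ℕ} (f : MvPolynomial (Fin n) ℝ) : ℝ :=
  sInf (bisphereValues f) / sSup (bisphereValues f)

/-- `f` is `r`-sos-convex: `yᵀ H_f(x) y · (∑ xᵢ²)^r` is a sum of squares of polynomials
in `(x, y)`. -/
def IsRSosConvex {n : ℕ} (r : ℕ) (f : MvPolynomial (Fin n) ℝ) : Prop :=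
  IsSumSq (hessianBiform f * (∑ i, X (Sum.inl i) ^ 2) ^ r)

theorem hessianBiformAt_eq {n : ℕ} (f : MvPolynomial (Fin n) ℝ)
    (x y : EuclideanSpace ℝ (Fin n)) :
    hessianBiformAt f x y =
      y.ofLp ⬝ᵥ Matrix.mulVec ((polyHessian f).map (eval x.ofLp)) y.ofLp := by
  simp [hessianBiformAt, hessianBiform, dotProduct, Matrix.mulVec, eval_rename, Finset.mul_sum,
    Function.comp_def, mul_assoc]

theorem isCompact_bisphereValues {n : ℕ} (f : MvPolynomial (Fin n) ℝ) :
    IsCompact (bisphereValues f) := by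
  have hc : Continuous fun p : EuclideanSpace ℝ (Fin n) × EuclideanSpace ℝ (Fin n) =>
      hessianBiformAt f p.1 p.2 := by
    refine (MvPolynomial.continuous_eval (hessianBiform f)).comp ?_
    refine continuous_pi fun i => ?_
    cases i with
    | inl i => simp only [Sum.elim_inl]; fun_prop
    | inr i => simp only [Sum.elim_inr]; fun_prop
  have h := ((isCompact_sphere (0 : EuclideanSpace ℝ (Fin n)) 1).prod
    (isCompact_sphere (0 : EuclideanSpace ℝ (Fin n)) 1)).image hc
  convert h using 1
  ext v
  simp [bisphereValues]

theorem bisphereValues_nonempty {n : ℕ} (hn : 1 ≤ n) (f : MvPolynomial (Fin n) ℝ) :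
    (bisphereValues f).Nonempty := by
  have hx : EuclideanSpace.single (⟨0, hn⟩ : Fin n) (1 : ℝ) ∈
      Metric.sphere (0 : EuclideanSpace ℝ (Fin n)) 1 := by simp
  exact ⟨_, _, hx, _, hx, rfl⟩

theorem isLeast_bisphereValues {n : ℕ} (hn : 1 ≤ n) (f : MvPolynomial (Fin n) ℝ) :
    IsLeast (bisphereValues f) (sInf (bisphereValues f)) :=
  (isCompact_bisphereValues f).isLeast_sInf (bisphereValues_nonempty hn f)

theorem isGreatest_bisphereValues {n : ℕ} (hn : 1 ≤ n) (f : MvPolynomial (Fin n) ℝ) :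
    IsGreatest (bisphereValues f) (sSup (bisphereValues f)) :=
  (isCompact_bisphereValues f).isGreatest_sSup (bisphereValues_nonempty hn f)

end

/-! Positivity on the bisphere forces `d = 2k + 2`. Let `p` be the Hessian form at fixed `y`, of
degree `2k` in `x`, and let `μ`, `M` be its extreme values on the bisphere. The core is a
Reznick-type representation: the operator `kernelInv`, written K, satisfies E[(K p)(u)
(x·u)^(2(r+k))] = c p(x) |x|^(2r) for Gaussian `u` and some `c > 0`. A cubature with nonnegative
weights makes the expectation a finite sum. Since K is linear, (K p)(u) is a quadratic form in `y`;
if it is nonnegative at all `u`, every summand is a sum of squares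
(`isRSosConvex_of_kernelInv_nonneg`).

K is the Hermite transform exp(-Δ/2) with each term made homogeneous by a power of |u|². On the
sphere K p is `p` plus multiples of Δ^j p, and Banach's theorem on symmetric multilinear forms gives
|Δ^j p| ≤ n^j (2k)!/(2k-2j)! M. Hence K p ≥ μ - M(e^a - 1) with a = n·2k(2k-1)/(4(n/2+r+k))
(`kernelInv_nonneg_of_exp_le`).

Using log(1+η) ≥ η log 2 here would give the threshold without its final `-d`. The gain comes from
`mul_le_of_bisphere_bounds`: M ≥ (d-1)μ, so η is small and log(1+η) is close to η, which saves
nearly a factor 1/log 2. For d ≥ 6 this pays for `d`. For d = 4 the Laplacian is bounded more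
sharply, and in two or three variables the Hessian form is, where needed, shown to be a sum of
squares outright by diagonalising the form of fourth derivatives on symmetric matrices. The cases d
= 2 and n = 1 are immediate. -/

noncomputable section

/-! ### Gaussian moments and a positive quadrature rule on the line -/

/-- The unnormalised moments of the standard Gaussian weight on the line. -/
def gaussMoment (j : ℕ) : ℝ := ∫ t : ℝ, t ^ j * Real.exp (-(1 / 2) * t ^ 2)

theorem integrable_pow_mul_gauss (j : ℕ) :
    MeasureTheory.Integrable fun t : ℝ => t ^ j * Real.exp (-(1 / 2) * t ^ 2) := by
  have h := integrable_rpow_mul_exp_neg_mul_sq (b := 1 / 2) (by norm_num) (s := j)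
    (by have : (0 : ℝ) ≤ j := j.cast_nonneg
        linarith)
  simpa only [Real.rpow_natCast] using h

theorem gaussMoment_zero_pos : 0 < gaussMoment 0 := by
  simp only [gaussMoment, pow_zero, one_mul]
  rw [integral_gaussian]
  positivity

/-- Integration by parts. At `j = 0` the truncated `j - 1` is harmless because of the factor `j`. -/
theorem gaussMoment_succ (j : ℕ) : gaussMoment (j + 1) = j * gaussMoment (j - 1) := by
  have hd : ∀ t : ℝ, HasDerivAt (fun t : ℝ => t ^ j * Real.exp (-(1 / 2) * t ^ 2))
      (j * (t ^ (j - 1) * Real.exp (-(1 / 2) * t ^ 2))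
        - t ^ (j + 1) * Real.exp (-(1 / 2) * t ^ 2)) t := by
    intro t
    have h1 := (hasDerivAt_pow j t).mul (((hasDerivAt_pow 2 t).const_mul (-(1 / 2 : ℝ))).exp)
    convert! h1 using 1
    simp only [Nat.cast_ofNat]
    ring
  have hi := ((integrable_pow_mul_gauss (j - 1)).const_mul (j : ℝ)).sub
    (integrable_pow_mul_gauss (j + 1))
  have h0 := MeasureTheory.integral_eq_zero_of_hasDerivAt_of_integrable hd hi
    (integrable_pow_mul_gauss j)
  rw [MeasureTheory.integral_sub ((integrable_pow_mul_gauss (j - 1)).const_mul (j : ℝ))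
    (integrable_pow_mul_gauss (j + 1)), MeasureTheory.integral_const_mul] at h0
  unfold gaussMoment
  linarith

/-- In finite dimension the convex hull of a compact set is compact. -/
theorem isCompact_convexHull_of_finiteDimensional {E : Type*} [NormedAddCommGroup E]
    [NormedSpace ℝ E] [FiniteDimensional ℝ E] {s : Set E} (hs : IsCompact s) :
    IsCompact (convexHull ℝ s) := by
  rcases s.eq_empty_or_nonempty with rfl | ⟨z₀, hz₀⟩
  · simp
  set N := Module.finrank ℝ E
  have hc : IsCompact ((fun q : (Fin (N + 1) → ℝ) × (Fin (N + 1) → E) => ∑ i, q.1 i • q.2 i) ''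
      (stdSimplex ℝ (Fin (N + 1)) ×ˢ Set.univ.pi fun _ => s)) :=
    ((isCompact_stdSimplex ℝ _).prod (isCompact_univ_pi fun _ => hs)).image (by fun_prop)
  convert hc using 1
  refine Set.Subset.antisymm (fun x hx => ?_) ?_
  · obtain ⟨ι, hι, z, w, hz, hai, hw, hw1, rfl⟩ := eq_pos_convex_span_of_mem_convexHull hx
    have hcard : Fintype.card ι ≤ Fintype.card (Fin (N + 1)) := by
      rw [Fintype.card_fin]
      exact hai.card_le_finrank_succ.trans (by gcongr; exact Submodule.finrank_le _)
    obtain ⟨e⟩ := Function.Embedding.nonempty_of_card_le hcard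
    refine ⟨(Function.extend e w 0, Function.extend e z fun _ => z₀), ⟨⟨fun i => ?_, ?_⟩, ?_⟩, ?_⟩
    · by_cases h : ∃ a, e a = i
      · obtain ⟨a, rfl⟩ := h
        simpa [e.injective.extend_apply] using (hw a).le
      · simp [Function.extend_apply' _ _ _ h]
    · rw [← hw1]
      refine (Fintype.sum_of_injective e e.injective _ _ (fun i hi => ?_) fun a => ?_).symm
      · simp [Function.extend_apply' _ _ _ hi]
      · simp [e.injective.extend_apply]
    · intro i _
      by_cases h : ∃ a, e a = i
      · obtain ⟨a, rfl⟩ := h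
        simpa [e.injective.extend_apply] using hz ⟨a, rfl⟩
      · simpa [Function.extend_apply' _ _ _ h] using hz₀
    · refine (Fintype.sum_of_injective e e.injective _ _ (fun i hi => ?_) fun a => ?_).symm
      · simp [Function.extend_apply' _ _ _ hi]
      · simp [e.injective.extend_apply]
  · rintro _ ⟨q, ⟨⟨hq0, hq1⟩, hq⟩, rfl⟩
    exact (convex_convexHull ℝ s).sum_mem (fun i _ => hq0 i) hq1
      fun i _ => subset_convexHull ℝ s (hq i trivial)

-- Tchakaloff's argument: after moving a factor (1+t²)^N into the weight, the normalised moment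
-- vector is an average of points of the bounded curve t^j/(1+t²)^N. The map `ψ` homogenises this
-- curve, placing it in a compact set, whose convex hull contains the average.
open MeasureTheory in
theorem exists_gauss_quadrature (D : ℕ) : ∃ (ι : Type) (_ : Fintype ι) (w t : ι → ℝ),
    (∀ i, 0 ≤ w i) ∧ ∀ j ≤ D, ∑ i, w i * t i ^ j = gaussMoment j := by
  set N := D + 1 with hN
  let ψ : ℝ × ℝ → Fin (D + 1) → ℝ := fun p j => p.1 ^ (j : ℕ) * p.2 ^ (2 * N - j)
  have hψ : Continuous ψ := by
    refine continuous_pi fun j => ?_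
    fun_prop
  set K : Set (Fin (D + 1) → ℝ) := ψ '' (Set.Icc (-1) 1 ×ˢ Set.Icc (-1) 1) with hK
  have hKc : IsCompact K := (isCompact_Icc.prod isCompact_Icc).image hψ
  let ρ : ℝ → ℝ := fun t => (1 + t ^ 2) ^ N * Real.exp (-(1 / 2) * t ^ 2)
  have hρ0 : ∀ t, 0 < ρ t := fun t => by positivity
  have hρc : Continuous ρ := by fun_prop
  have hρi : Integrable ρ := by
    have : ρ = fun t => ∑ i ∈ Finset.range (N + 1),
        (N.choose i : ℝ) * (t ^ (2 * (N - i)) * Real.exp (-(1 / 2) * t ^ 2)) := by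
      funext t
      simp only [ρ, add_pow, Finset.sum_mul, one_pow, one_mul]
      refine Finset.sum_congr rfl fun i _ => ?_
      rw [← pow_mul]
      ring
    rw [this]
    exact integrable_finsetSum _ fun i _ => (integrable_pow_mul_gauss _).const_mul _
  let f : ℝ → Fin (D + 1) → ℝ := fun t j => t ^ (j : ℕ) / (1 + t ^ 2) ^ N
  have hfK : ∀ t, f t ∈ K := by
    intro t
    have hs : (0 : ℝ) < 1 + t ^ 2 := by positivity
    have hq := Real.sqrt_pos.2 hs
    have hq2 := Real.sq_sqrt hs.le
    refine ⟨(t / √(1 + t ^ 2), 1 / √(1 + t ^ 2)), ⟨?_, ?_⟩, ?_⟩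
    · rw [Set.mem_Icc, ← abs_le, abs_div, abs_of_pos hq, div_le_one hq]
      exact Real.abs_le_sqrt (by linarith)
    · rw [Set.mem_Icc, ← abs_le, abs_div, abs_of_pos hq, div_le_one hq, abs_one]
      exact Real.one_le_sqrt.2 (by nlinarith [sq_nonneg t])
    · funext j
      have hj : (j : ℕ) + (2 * N - j) = 2 * N := by have := j.2; omega
      simp only [ψ, f]
      rw [div_pow, div_pow, one_pow, div_mul_div_comm, ← pow_add, hj, pow_mul, hq2, mul_one]
  let μ : Measure ℝ := volume.withDensity fun t => ENNReal.ofReal (ρ t)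
  have hμf : IsFiniteMeasure μ := isFiniteMeasure_withDensity_ofReal hρi.2
  have hρm : Measurable fun t => ENNReal.ofReal (ρ t) := hρc.measurable.ennreal_ofReal
  have hint : ∀ g : ℝ → ℝ, ∫ t, g t ∂μ = ∫ t, ρ t * g t := by
    intro g
    rw [integral_withDensity_eq_integral_toReal_smul hρm (by simp)]
    refine integral_congr_ae (Filter.Eventually.of_forall fun t => ?_)
    simp [ENNReal.toReal_ofReal (hρ0 t).le]
  have hμ0 : 0 < μ.real Set.univ := by
    have h1 : ∫ t, (1 : ℝ) ∂μ = μ.real Set.univ := by simp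
    rw [← h1, hint]
    simp only [mul_one]
    exact integral_pos_of_integrable_nonneg_nonzero hρc hρi (fun t => (hρ0 t).le) (hρ0 0).ne'
  have hne : NeZero μ := ⟨by
    rintro h
    rw [h] at hμ0
    simp at hμ0⟩
  have hfc : Continuous f := by
    refine continuous_pi fun j => ?_
    refine Continuous.div (by fun_prop) (by fun_prop) fun t => ?_
    positivity
  have hfi : Integrable f μ := by
    obtain ⟨C, hC⟩ := hKc.isBounded.exists_norm_le
    exact Integrable.of_bound hfc.aestronglyMeasurable C
      (Filter.Eventually.of_forall fun t => hC _ (hfK t))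
  have hmem := (convex_convexHull ℝ K).average_mem (μ := μ) (f := f) (isCompact_convexHull_of_finiteDimensional hKc).isClosed
    (Filter.Eventually.of_forall fun t => subset_convexHull ℝ K (hfK t)) hfi
  rw [mem_convexHull_iff_exists_fintype] at hmem
  obtain ⟨ι, hι, w, z, hw, -, hz, hsum⟩ := hmem
  choose p hp hpz using hz
  refine ⟨ι, hι, fun i => μ.real Set.univ * w i * (p i).2 ^ (2 * N),
    fun i => (p i).1 / (p i).2, fun i => ?_, fun j hj => ?_⟩
  · have := hw i
    have h2 : 0 ≤ (p i).2 ^ (2 * N) := by rw [pow_mul]; positivity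
    positivity
  · have h1 := congrFun hsum ⟨j, by omega⟩
    rw [average_eq, Pi.smul_apply, Finset.sum_apply] at h1
    have h2 : (∫ t, f t ∂μ) ⟨j, by omega⟩ = gaussMoment j := by
      have h3 := (ContinuousLinearMap.proj (R := ℝ) (φ := fun _ : Fin (D + 1) => ℝ)
        ⟨j, by omega⟩).integral_comp_comm hfi
      simp only [ContinuousLinearMap.proj_apply] at h3
      rw [← h3, hint]
      refine integral_congr_ae (Filter.Eventually.of_forall fun t => ?_)
      have : (1 + t ^ 2) ^ N ≠ 0 := by positivity
      simp only [ρ, f]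
      field_simp
    rw [h2, smul_eq_mul, ← div_eq_inv_mul, eq_div_iff hμ0.ne', Finset.sum_mul] at h1
    rw [← h1]
    refine Finset.sum_congr rfl fun i _ => ?_
    rw [Pi.smul_apply, ← hpz i, smul_eq_mul]
    simp only [ψ]
    have h4 : (p i).1 ^ j * (p i).2 ^ (2 * N - j)
        = ((p i).1 / (p i).2) ^ j * (p i).2 ^ (2 * N) := by
      rcases eq_or_ne (p i).2 0 with h0 | h0
      · rw [h0, zero_pow (by omega), zero_pow (by omega)]
        simp
      · rw [div_pow, ← Nat.sub_add_cancel (show j ≤ 2 * N by omega), pow_add]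
        simp only [Nat.sub_add_cancel (show j ≤ 2 * N by omega)]
        field_simp
    rw [h4]
    ring

/-! ### Gaussian expectation of polynomials and cubature -/

/-- The (unnormalised) Gaussian expectation as a linear functional on polynomials. -/
def gaussExpect (n : ℕ) : MvPolynomial (Fin n) ℝ →ₗ[ℝ] ℝ :=
  (basisMonomials (Fin n) ℝ).constr ℝ fun α => ∏ i, gaussMoment (α i)

theorem gaussExpect_monomial {n : ℕ} (α : Fin n →₀ ℕ) (a : ℝ) :
    gaussExpect n (monomial α a) = a * ∏ i, gaussMoment (α i) := by
  have h := (basisMonomials (Fin n) ℝ).constr_basis ℝ (fun α => ∏ i, gaussMoment (α i)) α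
  rw [coe_basisMonomials] at h
  have h2 : monomial α a = a • monomial α (1 : ℝ) := by rw [smul_monomial, smul_eq_mul, mul_one]
  rw [h2, map_smul, smul_eq_mul]
  exact congrArg _ h

theorem gaussExpect_one_pos (n : ℕ) : 0 < gaussExpect n 1 := by
  rw [show (1 : MvPolynomial (Fin n) ℝ) = monomial 0 1 from rfl, gaussExpect_monomial]
  simp only [Finsupp.coe_zero, Pi.zero_apply, one_mul]
  exact Finset.prod_pos fun _ _ => gaussMoment_zero_pos

/-- Gaussian integration by parts, read off monomials from `gaussMoment_succ`. -/
theorem gaussExpect_X_mul {n : ℕ} (i : Fin n) (q : MvPolynomial (Fin n) ℝ) :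
    gaussExpect n (X i * q) = gaussExpect n (pderiv i q) := by
  induction q using MvPolynomial.induction_on' with
  | monomial α a =>
    rw [pderiv_monomial, X, monomial_mul, gaussExpect_monomial, gaussExpect_monomial,
      Fintype.prod_eq_mul_prod_compl i, Fintype.prod_eq_mul_prod_compl i]
    have h1 : (Finsupp.single i 1 + α : Fin n →₀ ℕ) i = α i + 1 := by simp [add_comm]
    have h2 : (α - Finsupp.single i 1 : Fin n →₀ ℕ) i = α i - 1 := by simp
    rw [h1, h2, gaussMoment_succ]
    have h3 : ∏ x ∈ {i}ᶜ, gaussMoment ((Finsupp.single i 1 + α : Fin n →₀ ℕ) x)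
        = ∏ x ∈ {i}ᶜ, gaussMoment ((α - Finsupp.single i 1 : Fin n →₀ ℕ) x) := by
      refine Finset.prod_congr rfl fun x hx => ?_
      have : i ≠ x := by
        rintro rfl
        simp at hx
      simp [this]
    rw [h3]
    ring
  | add p q hp hq => rw [mul_add, map_add, map_add, map_add, hp, hq]

/-- The tensor power of the one-dimensional rule: no exponent of a monomial exceeds its total
degree. -/
theorem exists_gauss_cubature (n D : ℕ) : ∃ (ι : Type) (_ : Fintype ι) (w : ι → ℝ)
    (u : ι → Fin n → ℝ), (∀ a, 0 ≤ w a) ∧ ∀ q : MvPolynomial (Fin n) ℝ, q.totalDegree ≤ D →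
      gaussExpect n q = ∑ a, w a * eval (u a) q := by
  classical
  obtain ⟨ι, hι, w, t, hw, hq⟩ := exists_gauss_quadrature D
  refine ⟨Fin n → ι, inferInstance, fun κ => ∏ i, w (κ i), fun κ i => t (κ i),
    fun κ => Finset.prod_nonneg fun i _ => hw _, fun q hD => ?_⟩
  have h1 : ∀ α ∈ q.support, gaussExpect n (monomial α (q.coeff α))
      = ∑ κ : Fin n → ι, (∏ i, w (κ i)) * eval (fun i => t (κ i)) (monomial α (q.coeff α)) := by
    intro α hα
    have hαi : ∀ i, α i ≤ D := fun i => (Finsupp.le_degree i α).trans ((le_totalDegree hα : α.degree ≤ _).trans hD)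
    rw [gaussExpect_monomial]
    simp only [← hq _ (hαi _)]
    rw [Finset.prod_univ_sum, Fintype.piFinset_univ, Finset.mul_sum]
    refine Finset.sum_congr rfl fun κ _ => ?_
    rw [eval_monomial, Finset.prod_mul_distrib, Finsupp.prod_fintype _ _ (by simp)]
    ring
  conv_lhs => rw [q.as_sum]
  conv_rhs => rw [q.as_sum]
  rw [map_sum, Finset.sum_congr rfl h1, Finset.sum_comm]
  refine Finset.sum_congr rfl fun κ _ => ?_
  rw [map_sum, Finset.mul_sum]

/-! ### The Laplacian, the Hermite transform and powers of linear forms -/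

/-- The Laplacian on polynomials. -/
def polyLaplacian (n : ℕ) : MvPolynomial (Fin n) ℝ →ₗ[ℝ] MvPolynomial (Fin n) ℝ :=
  ∑ i, (pderiv i).toLinearMap ∘ₗ (pderiv i).toLinearMap

theorem polyLaplacian_apply {n : ℕ} (p : MvPolynomial (Fin n) ℝ) :
    polyLaplacian n p = ∑ i, pderiv i (pderiv i p) := by
  simp [polyLaplacian]

theorem pderiv_pderiv_comm {σ : Type*} (i j : σ) (p : MvPolynomial σ ℝ) :
    pderiv i (pderiv j p) = pderiv j (pderiv i p) := by
  classical
  have h : ⁅pderiv (R := ℝ) i, pderiv (R := ℝ) j⁆ = 0 := by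
    refine MvPolynomial.derivation_ext fun l => ?_
    rw [Derivation.commutator_apply, pderiv_X, pderiv_X, Derivation.zero_apply]
    simp only [Pi.single_apply]
    split_ifs <;> simp
  have h2 := congrArg (fun D => D p) h
  simp only [Derivation.commutator_apply, Derivation.zero_apply] at h2
  exact sub_eq_zero.1 h2

theorem pderiv_polyLaplacian {n : ℕ} (i : Fin n) (p : MvPolynomial (Fin n) ℝ) :
    pderiv i (polyLaplacian n p) = polyLaplacian n (pderiv i p) := by
  rw [polyLaplacian_apply, polyLaplacian_apply, map_sum]
  refine Finset.sum_congr rfl fun j _ => ?_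
  rw [pderiv_pderiv_comm i j, pderiv_pderiv_comm i j]

theorem polyLaplacian_X_mul {n : ℕ} (i : Fin n) (p : MvPolynomial (Fin n) ℝ) :
    polyLaplacian n (X i * p) = X i * polyLaplacian n p + 2 * pderiv i p := by
  have h : ∀ j : Fin n, pderiv j (pderiv j (X i * p))
      = X i * pderiv j (pderiv j p) + if j = i then 2 * pderiv i p else 0 := by
    intro j
    rcases eq_or_ne j i with rfl | hji
    · simp
      ring
    · simp [pderiv_X_of_ne hji.symm, hji]
  rw [polyLaplacian_apply, polyLaplacian_apply, Finset.sum_congr rfl fun j _ => h j,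
    Finset.sum_add_distrib, Finset.mul_sum, Finset.sum_ite_eq' Finset.univ i]
  simp

theorem polyLaplacian_pow_X_mul {n : ℕ} (i : Fin n) (j : ℕ) (p : MvPolynomial (Fin n) ℝ) :
    (polyLaplacian n ^ (j + 1)) (X i * p)
      = X i * (polyLaplacian n ^ (j + 1)) p + (2 * (j + 1) : ℝ) • pderiv i ((polyLaplacian n ^ j) p)
    := by
  induction j with
  | zero =>
    simp only [zero_add, pow_one, pow_zero, Module.End.one_apply]
    rw [polyLaplacian_X_mul, MvPolynomial.smul_eq_C_mul, Nat.cast_zero, zero_add, mul_one, map_ofNat]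
  | succ j ih =>
    rw [pow_succ' _ (j + 1), Module.End.mul_apply, ih, map_add, map_smul, polyLaplacian_X_mul,
      ← pderiv_polyLaplacian, ← Module.End.mul_apply, ← Module.End.mul_apply, ← pow_succ',
      ← pow_succ']
    simp only [MvPolynomial.smul_eq_C_mul]
    push_cast
    simp only [map_mul, map_add, map_ofNat, map_one, map_natCast]
    ring

theorem isHomogeneous_polyLaplacian_pow {n e : ℕ} {p : MvPolynomial (Fin n) ℝ}
    (hp : p.IsHomogeneous e) (j : ℕ) : ((polyLaplacian n ^ j) p).IsHomogeneous (e - 2 * j) := by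
  induction j with
  | zero => simpa using hp
  | succ j ih =>
    rw [pow_succ', Module.End.mul_apply, polyLaplacian_apply]
    refine IsHomogeneous.sum _ _ _ fun i _ => ?_
    have := (ih.pderiv (i := i)).pderiv (i := i)
    rwa [show e - 2 * j - 1 - 1 = e - 2 * (j + 1) by omega] at this

theorem pderiv_eq_zero_of_isHomogeneous_zero {σ : Type*} {p : MvPolynomial σ ℝ}
    (hp : p.IsHomogeneous 0) (i : σ) : pderiv i p = 0 := by
  rw [← totalDegree_zero_iff_isHomogeneous, totalDegree_eq_zero_iff_eq_C] at hp
  rw [hp, pderiv_C]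

/-- The truncated Hermite transform `∑ (-1/2)^j / j! Δ^j`. -/
def hermite (n J : ℕ) : MvPolynomial (Fin n) ℝ →ₗ[ℝ] MvPolynomial (Fin n) ℝ :=
  ∑ j ∈ Finset.range J, ((-(1 / 2 : ℝ)) ^ j / j.factorial) • polyLaplacian n ^ j

theorem hermite_apply {n J : ℕ} (p : MvPolynomial (Fin n) ℝ) : hermite n J p
    = ∑ j ∈ Finset.range J, ((-(1 / 2 : ℝ)) ^ j / j.factorial) • (polyLaplacian n ^ j) p := by
  simp [hermite]

/-- exp(-Δ/2) intertwines `X i` with `X i - ∂ᵢ`, the Gaussian adjoint of `∂ᵢ`, because [Δ^(j+1), X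
i] = 2(j+1) ∂ᵢ Δ^j. The truncation is invisible: `e ≤ 2 * J` makes Δ^J p constant. -/
theorem hermite_X_mul {n J e : ℕ} (i : Fin n) {p : MvPolynomial (Fin n) ℝ}
    (hp : p.IsHomogeneous e) (he : e ≤ 2 * J) : hermite n (J + 1) (X i * p)
      = X i * hermite n (J + 1) p - pderiv i (hermite n (J + 1) p) := by
  have h1 : pderiv i (hermite n (J + 1) p) = pderiv i (hermite n J p) := by
    have h0 := isHomogeneous_polyLaplacian_pow hp J
    rw [Nat.sub_eq_zero_of_le he] at h0
    rw [hermite_apply, Finset.sum_range_succ, map_add, Derivation.map_smul,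
      pderiv_eq_zero_of_isHomogeneous_zero h0, smul_zero, add_zero, ← hermite_apply]
  rw [h1, hermite_apply, hermite_apply, hermite_apply, Finset.sum_range_succ',
    Finset.sum_range_succ', map_sum, mul_add, Finset.mul_sum, add_sub_right_comm,
    ← Finset.sum_sub_distrib]
  congr 1
  · refine Finset.sum_congr rfl fun j _ => ?_
    rw [polyLaplacian_pow_X_mul, smul_add, smul_smul, mul_smul_comm, Derivation.map_smul,
      sub_eq_add_neg, ← neg_smul]
    congr 2
    rw [Nat.factorial_succ]
    push_cast
    have : (j.factorial : ℝ) ≠ 0 := by positivity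
    field_simp
    ring
  · simp

theorem hermite_C {n J : ℕ} (c : ℝ) : hermite n (J + 1) (C c) = C c := by
  rw [hermite_apply, Finset.sum_range_succ', Finset.sum_eq_zero fun j _ => ?_]
  · simp
  · rw [pow_succ (polyLaplacian n), Module.End.mul_apply, polyLaplacian_apply]
    simp

/-- The linear form `u ↦ x ⬝ u`. -/
def linForm {n : ℕ} (x : Fin n → ℝ) : MvPolynomial (Fin n) ℝ := ∑ i, C (x i) * X i

theorem pderiv_linForm {n : ℕ} (x : Fin n → ℝ) (i : Fin n) :
    pderiv i (linForm x) = C (x i) := by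
  rw [linForm, map_sum, Finset.sum_eq_single i]
  · simp
  · intro j _ hj
    simp [pderiv_X_of_ne hj]
  · simp

theorem isHomogeneous_linForm {n : ℕ} (x : Fin n → ℝ) : (linForm x).IsHomogeneous 1 :=
  IsHomogeneous.sum _ _ _ fun i _ => (isHomogeneous_X ℝ i).C_mul _

theorem pderiv_linForm_pow_succ {n : ℕ} (x : Fin n → ℝ) (i : Fin n) (N : ℕ) :
    pderiv i (linForm x ^ (N + 1)) = ((N + 1) * x i : ℝ) • linForm x ^ N := by
  rw [pderiv_pow, pderiv_linForm, MvPolynomial.smul_eq_C_mul]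
  simp only [map_mul, map_add, map_one, map_natCast, Nat.add_sub_cancel]
  push_cast
  ring

/-- Induction on the degree through Euler's identity (e+1)p = ∑ X i ∂ᵢp. Each summand becomes `(X i
- ∂ᵢ) h`, and integration by parts moves the derivative onto the power of the linear form, lowering
that power by one and producing `x i`. -/
theorem gaussExpect_hermite_mul {n : ℕ} (x : Fin n → ℝ) (e : ℕ) :
    ∀ (J a : ℕ) (p : MvPolynomial (Fin n) ℝ), p.IsHomogeneous e → e < 2 * J →
      gaussExpect n (hermite n J p * linForm x ^ (e + a)) * a.factorial
        = (e + a).factorial * eval x p * gaussExpect n (linForm x ^ a) := by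
  induction e with
  | zero =>
    intro J a p hp hJ
    obtain ⟨J, rfl⟩ : ∃ J', J = J' + 1 := ⟨J - 1, by omega⟩
    rw [← totalDegree_zero_iff_isHomogeneous, totalDegree_eq_zero_iff_eq_C] at hp
    rw [hp, hermite_C, ← MvPolynomial.smul_eq_C_mul, map_smul, zero_add, eval_C, smul_eq_mul]
    ring
  | succ e ih =>
    intro J a p hp hJ
    obtain ⟨J, rfl⟩ : ∃ J', J = J' + 1 := ⟨J - 1, by omega⟩
    have hEuler := hp.sum_X_mul_pderiv
    have hpi : ∀ i, (pderiv i p).IsHomogeneous e := fun i => hp.pderiv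
    have hstep : ∀ i, gaussExpect n (hermite n (J + 1) (X i * pderiv i p) * linForm x ^ (e + 1 + a))
        * a.factorial
        = (e + 1 + a).factorial * (x i * eval x (pderiv i p)) * gaussExpect n (linForm x ^ a) := by
      intro i
      set h := hermite n (J + 1) (pderiv i p) with hh
      have h1 : (X i * h - pderiv i h) * linForm x ^ (e + 1 + a)
          = X i * (h * linForm x ^ (e + 1 + a)) - pderiv i (h * linForm x ^ (e + 1 + a))
            + ((e + a + 1 : ℝ) * x i) • (h * linForm x ^ (e + a)) := by
        rw [pderiv_mul, show e + 1 + a = e + a + 1 by ring, pderiv_linForm_pow_succ, mul_smul_comm]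
        push_cast
        ring
      rw [hermite_X_mul i (hpi i) (by omega), ← hh, h1, map_add, map_sub, gaussExpect_X_mul, sub_self,
        zero_add, map_smul, smul_eq_mul, mul_assoc, ih (J + 1) a _ (hpi i) (by omega),
        show e + 1 + a = (e + a) + 1 by ring, Nat.factorial_succ]
      push_cast
      ring
    have h2 : (e + 1 : ℝ) * (gaussExpect n (hermite n (J + 1) p * linForm x ^ (e + 1 + a))
        * a.factorial) = (e + 1 : ℝ) * ((e + 1 + a).factorial * eval x p
          * gaussExpect n (linForm x ^ a)) := by
      have h3 := Finset.sum_congr rfl fun i (_ : i ∈ Finset.univ) => hstep i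
      rw [← Finset.sum_mul, ← map_sum, ← Finset.sum_mul, ← map_sum, hEuler, ← Finset.sum_mul,
        ← Finset.mul_sum] at h3
      have h4 : ∑ i, x i * eval x (pderiv i p) = (e + 1) * eval x p := by
        have := congrArg (eval x) hEuler
        rw [map_sum, nsmul_eq_mul] at this
        simpa using this
      rw [h4, map_nsmul, nsmul_eq_mul, Nat.cast_add, Nat.cast_one] at h3
      have h5 : ((e : MvPolynomial (Fin n) ℝ) + 1) * hermite n (J + 1) p * linForm x ^ (e + 1 + a)
          = ((e : ℝ) + 1) • (hermite n (J + 1) p * linForm x ^ (e + 1 + a)) := by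
        rw [MvPolynomial.smul_eq_C_mul]
        simp only [map_add, map_one, map_natCast]
        ring
      rw [h5, map_smul, smul_eq_mul] at h3
      linarith
    exact mul_left_cancel₀ (by positivity) h2

theorem gaussExpect_linForm_pow {n : ℕ} (x : Fin n → ℝ) (a : ℕ) :
    gaussExpect n (linForm x ^ (2 * a))
      = (∏ i ∈ Finset.range a, (2 * i + 1 : ℝ)) * (∑ i, x i ^ 2) ^ a * gaussExpect n 1 := by
  induction a with
  | zero => simp
  | succ a ih =>
    have h : linForm x ^ (2 * (a + 1)) = ∑ i, x i • (X i * linForm x ^ (2 * a + 1)) := by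
      rw [show 2 * (a + 1) = 2 * a + 1 + 1 by ring, pow_succ' _ (2 * a + 1)]
      conv_lhs => rw [linForm, Finset.sum_mul]
      refine Finset.sum_congr rfl fun i _ => ?_
      rw [← linForm, MvPolynomial.smul_eq_C_mul]
      ring
    rw [h, map_sum, Finset.prod_range_succ, pow_succ (∑ i, x i ^ 2), Finset.mul_sum, Finset.mul_sum,
      Finset.sum_mul]
    refine Finset.sum_congr rfl fun i _ => ?_
    rw [map_smul, gaussExpect_X_mul, pderiv_linForm_pow_succ, map_smul, ih, smul_eq_mul, smul_eq_mul]
    push_cast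
    ring

/-- The squared norm as a polynomial. -/
def normSqPoly (n : ℕ) : MvPolynomial (Fin n) ℝ := ∑ i, X i ^ 2

theorem isHomogeneous_normSqPoly (n : ℕ) : (normSqPoly n).IsHomogeneous 2 :=
  IsHomogeneous.sum _ _ _ fun i _ => isHomogeneous_X_pow i 2

/-- One integration by parts and Euler's identity. Powers of |u|² can thus be inserted at the price
of an explicit constant. -/
theorem gaussExpect_normSqPoly_mul {n e : ℕ} {q : MvPolynomial (Fin n) ℝ}
    (hq : q.IsHomogeneous e) : gaussExpect n (normSqPoly n * q) = (n + e) * gaussExpect n q := by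
  have h : ∀ i, gaussExpect n (X i ^ 2 * q) = gaussExpect n q + gaussExpect n (X i * pderiv i q) := by
    intro i
    rw [pow_two, mul_assoc, gaussExpect_X_mul, pderiv_mul, pderiv_X_self, one_mul, map_add]
  rw [normSqPoly, Finset.sum_mul, map_sum, Finset.sum_congr rfl fun i _ => h i,
    Finset.sum_add_distrib, ← map_sum (gaussExpect n) fun i => X i * pderiv i q,
    hq.sum_X_mul_pderiv, map_nsmul]
  simp
  ring

theorem gaussExpect_normSqPoly_pow_mul {n e : ℕ} {q : MvPolynomial (Fin n) ℝ}
    (hq : q.IsHomogeneous e) (j : ℕ) : gaussExpect n (normSqPoly n ^ j * q)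
      = (∏ i ∈ Finset.range j, (n + e + 2 * i : ℝ)) * gaussExpect n q := by
  induction j with
  | zero => simp
  | succ j ih =>
    rw [pow_succ', mul_assoc, gaussExpect_normSqPoly_mul (((isHomogeneous_normSqPoly n).pow j).mul hq),
      ih, Finset.prod_range_succ]
    push_cast
    ring

/-! ### The inverting kernel -/

/-- The coefficients of the operator inverting integration against `(x ⬝ u) ^ (2 (r + k))`. -/
def invCoeff (n k r j : ℕ) : ℝ :=
  (-(1 / 2 : ℝ)) ^ j / j.factorial /
    ∏ i ∈ Finset.range j, (n + (2 * (r + 2 * k - j) : ℕ) + 2 * i : ℝ)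

/-- Up to a positive factor, the operator inverting integration against `(x ⬝ u) ^ (2 (r + k))`
on forms of degree `2 k`. -/
def kernelInv (n k r : ℕ) : MvPolynomial (Fin n) ℝ →ₗ[ℝ] MvPolynomial (Fin n) ℝ :=
  ∑ j ∈ Finset.range (k + 1), invCoeff n k r j •
    (LinearMap.mulLeft ℝ (normSqPoly n ^ j) ∘ₗ polyLaplacian n ^ j)

theorem kernelInv_apply {n k r : ℕ} (p : MvPolynomial (Fin n) ℝ) : kernelInv n k r p
    = ∑ j ∈ Finset.range (k + 1),
      invCoeff n k r j • (normSqPoly n ^ j * (polyLaplacian n ^ j) p) := by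
  simp [kernelInv]

theorem isHomogeneous_kernelInv {n k r : ℕ} {p : MvPolynomial (Fin n) ℝ}
    (hp : p.IsHomogeneous (2 * k)) : (kernelInv n k r p).IsHomogeneous (2 * k) := by
  rw [kernelInv_apply]
  refine IsHomogeneous.sum _ _ _ fun j hj => ?_
  have hj' := Finset.mem_range.1 hj
  have h := ((isHomogeneous_normSqPoly n).pow j).mul (isHomogeneous_polyLaplacian_pow hp j)
  rw [show 2 * j + (2 * k - 2 * j) = 2 * k by omega] at h
  rw [MvPolynomial.smul_eq_C_mul]
  exact h.C_mul _

/-- The denominators in `invCoeff` cancel exactly the constants produced by the factors |u|^(2j),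
the remaining integrand having degree 2(r+2k-j). So the expectation is that of the Hermite
transform, while `kernelInv` itself preserves homogeneity. -/
theorem gaussExpect_kernelInv_mul {n k r : ℕ} (hn : 1 ≤ n) :
    ∃ c : ℝ, 0 < c ∧ ∀ (p : MvPolynomial (Fin n) ℝ) (x : Fin n → ℝ), p.IsHomogeneous (2 * k) →
      gaussExpect n (kernelInv n k r p * linForm x ^ (2 * (r + k)))
        = c * (eval x p * (∑ i, x i ^ 2) ^ r) := by
  refine ⟨((2 * k + 2 * r).factorial : ℝ) / (2 * r).factorial *
    (∏ i ∈ Finset.range r, (2 * i + 1 : ℝ)) * gaussExpect n 1, ?_, fun p x hp => ?_⟩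
  · have := gaussExpect_one_pos n
    have h2 : 0 < ∏ i ∈ Finset.range r, (2 * i + 1 : ℝ) := Finset.prod_pos fun i _ => by positivity
    positivity
  have h1 : gaussExpect n (kernelInv n k r p * linForm x ^ (2 * (r + k)))
      = gaussExpect n (hermite n (k + 1) p * linForm x ^ (2 * k + 2 * r)) := by
    rw [kernelInv_apply, hermite_apply, Finset.sum_mul, Finset.sum_mul, map_sum, map_sum]
    refine Finset.sum_congr rfl fun j hj => ?_
    have hj' := Finset.mem_range.1 hj
    have hq := (isHomogeneous_polyLaplacian_pow hp j).mul
      ((isHomogeneous_linForm x).pow (2 * (r + k)))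
    rw [show 2 * k - 2 * j + 1 * (2 * (r + k)) = 2 * (r + 2 * k - j) by omega] at hq
    rw [smul_mul_assoc, map_smul, mul_assoc, gaussExpect_normSqPoly_pow_mul hq, smul_mul_assoc,
      map_smul, smul_eq_mul, smul_eq_mul, invCoeff, show 2 * k + 2 * r = 2 * (r + k) by ring]
    have h0 : (∏ i ∈ Finset.range j, (n + (2 * (r + 2 * k - j) : ℕ) + 2 * i : ℝ)) ≠ 0 := by
      refine Finset.prod_ne_zero_iff.2 fun i _ => ?_
      have : (1 : ℝ) ≤ n := by exact_mod_cast hn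
      positivity
    field_simp
  have h2 := gaussExpect_hermite_mul x (2 * k) (k + 1) (2 * r) p hp (by omega)
  rw [gaussExpect_linForm_pow] at h2
  rw [h1]
  have h3 : ((2 * r).factorial : ℝ) ≠ 0 := by positivity
  field_simp
  linarith

/-! ### Directional derivatives; from a nonnegative kernel to sums of squares -/

/-- The derivative in the direction of `v`. -/
def dirDeriv {n : ℕ} (v : Fin n → ℝ) : MvPolynomial (Fin n) ℝ →ₗ[ℝ] MvPolynomial (Fin n) ℝ :=
  ∑ i, v i • (pderiv i).toLinearMap

theorem dirDeriv_apply {n : ℕ} (v : Fin n → ℝ) (p : MvPolynomial (Fin n) ℝ) :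
    dirDeriv v p = ∑ i, v i • pderiv i p := by
  simp [dirDeriv]

theorem dirDeriv_add {n : ℕ} (v w : Fin n → ℝ) (p : MvPolynomial (Fin n) ℝ) :
    dirDeriv (v + w) p = dirDeriv v p + dirDeriv w p := by
  simp [dirDeriv_apply, add_smul, Finset.sum_add_distrib]

theorem dirDeriv_smul {n : ℕ} (c : ℝ) (v : Fin n → ℝ) (p : MvPolynomial (Fin n) ℝ) :
    dirDeriv (c • v) p = c • dirDeriv v p := by
  simp [dirDeriv_apply, mul_smul, Finset.smul_sum]

theorem dirDeriv_single {n : ℕ} (i : Fin n) (p : MvPolynomial (Fin n) ℝ) :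
    dirDeriv (Pi.single i 1) p = pderiv i p := by
  rw [dirDeriv_apply, Finset.sum_eq_single i]
  · simp
  · intro j _ hj
    simp [hj]
  · simp

theorem dirDeriv_comm {n : ℕ} (v w : Fin n → ℝ) (p : MvPolynomial (Fin n) ℝ) :
    dirDeriv v (dirDeriv w p) = dirDeriv w (dirDeriv v p) := by
  simp only [dirDeriv_apply, map_sum, Derivation.map_smul]
  rw [Finset.sum_comm]
  refine Finset.sum_congr rfl fun i _ => Finset.sum_congr rfl fun j _ => ?_
  rw [pderiv_pderiv_comm, smul_comm]

theorem isHomogeneous_dirDeriv {n e : ℕ} {p : MvPolynomial (Fin n) ℝ} (hp : p.IsHomogeneous e)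
    (v : Fin n → ℝ) : (dirDeriv v p).IsHomogeneous (e - 1) := by
  rw [dirDeriv_apply]
  refine IsHomogeneous.sum _ _ _ fun i _ => ?_
  rw [MvPolynomial.smul_eq_C_mul]
  exact hp.pderiv.C_mul _

theorem dirDeriv_dirDeriv_eq_sum {n : ℕ} (y : Fin n → ℝ) (f : MvPolynomial (Fin n) ℝ) :
    dirDeriv y (dirDeriv y f) = ∑ i, ∑ j, (y i * y j) • polyHessian f i j := by
  simp only [dirDeriv_apply, map_sum, Derivation.map_smul, mul_smul, polyHessian, Matrix.of_apply]
  exact Finset.sum_congr rfl fun i _ => Finset.sum_congr rfl fun j _ => by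
    rw [pderiv_pderiv_comm, smul_comm]

theorem eval_hessianBiform {n : ℕ} (f : MvPolynomial (Fin n) ℝ) (x y : Fin n → ℝ) :
    eval (Sum.elim x y) (hessianBiform f) = eval x (dirDeriv y (dirDeriv y f)) := by
  simp only [dirDeriv_dirDeriv_eq_sum, hessianBiform, map_sum, map_mul, eval_X, eval_rename,
    Sum.elim_inr, smul_eval, Sum.elim_comp_inl]
  exact Finset.sum_congr rfl fun i _ => Finset.sum_congr rfl fun j _ => by ring

theorem isSumSq_C {σ : Type*} {a : ℝ} (ha : 0 ≤ a) : IsSumSq (C a : MvPolynomial σ ℝ) := by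
  rw [← Real.mul_self_sqrt ha, map_mul]
  exact IsSumSq.mul_self _

theorem isSumSq_of_psd {σ κ : Type*} [Fintype κ] (G : κ → κ → ℝ) (hG : ∀ i j, G i j = G j i)
    (hpos : ∀ z : κ → ℝ, 0 ≤ ∑ i, ∑ j, G i j * z i * z j) (Z : κ → MvPolynomial σ ℝ) :
    IsSumSq (∑ i, ∑ j, C (G i j) * Z i * Z j) := by
  have hP : (Matrix.of G).PosSemidef := by
    refine Matrix.PosSemidef.of_dotProduct_mulVec_nonneg ?_ fun z => ?_
    · ext i j
      simp [hG i j]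
    · have h := hpos z
      simp only [dotProduct, Matrix.mulVec, Matrix.of_apply, Pi.star_apply, star_trivial,
        Finset.mul_sum]
      refine h.trans_eq (Finset.sum_congr rfl fun i _ => Finset.sum_congr rfl fun j _ => by ring)
  obtain ⟨m, A, hA⟩ := Matrix.posSemidef_iff_eq_sum_vecMulVec.mp hP
  have hG' : ∀ i j, G i j = ∑ a, A a i * A a j := by
    intro i j
    have h := congrFun (congrFun hA i) j
    simpa [Matrix.sum_apply, Matrix.vecMulVec_apply] using h
  have h : ∑ i, ∑ j, C (G i j) * Z i * Z j
      = ∑ a, (∑ i, C (A a i) * Z i) * (∑ j, C (A a j) * Z j) := by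
    simp only [hG', map_sum, map_mul, Finset.sum_mul, Finset.mul_sum]
    calc _ = ∑ i, ∑ a, ∑ j, C (A a i) * C (A a j) * Z i * Z j :=
          Finset.sum_congr rfl fun i _ => Finset.sum_comm
      _ = ∑ a, ∑ i, ∑ j, C (A a i) * C (A a j) * Z i * Z j := Finset.sum_comm
      _ = ∑ a, ∑ j, ∑ i, C (A a i) * C (A a j) * Z i * Z j :=
          Finset.sum_congr rfl fun a _ => Finset.sum_comm
      _ = _ := Finset.sum_congr rfl fun a _ => by
          rw [Finset.sum_comm]
          exact Finset.sum_congr rfl fun i _ => Finset.sum_congr rfl fun j _ => by ring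
  rw [h]
  exact IsSumSq.sum_mul_self _ _

/-- Each cubature node contributes a nonnegative weight, a positive semidefinite quadratic form in
`y`, and an even power of a linear form in `x`. -/
theorem isRSosConvex_of_kernelInv_nonneg {n k r : ℕ} (hn : 1 ≤ n) {f : MvPolynomial (Fin n) ℝ}
    (hf : f.IsHomogeneous (2 * k + 2))
    (hpos : ∀ u y : Fin n → ℝ, 0 ≤ eval u (kernelInv n k r (dirDeriv y (dirDeriv y f)))) :
    IsRSosConvex r f := by
  obtain ⟨c, hc, hker⟩ := gaussExpect_kernelInv_mul (k := k) (r := r) hn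
  -- The exactness degree is that of the kernel, `2 * k`, plus that of the linear form power.
  obtain ⟨ι, _, w, u, hw, hcub⟩ := exists_gauss_cubature n (2 * k + 2 * (r + k))
  let G : ι → Fin n → Fin n → ℝ := fun a i j => eval (u a) (kernelInv n k r (polyHessian f i j))
  have hG : ∀ a y, eval (u a) (kernelInv n k r (dirDeriv y (dirDeriv y f)))
      = ∑ i, ∑ j, G a i j * y i * y j := by
    intro a y
    simp only [dirDeriv_dirDeriv_eq_sum, map_sum, map_smul, smul_eval, G]
    exact Finset.sum_congr rfl fun i _ => Finset.sum_congr rfl fun j _ => by ring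
  have hsos : IsSumSq (∑ a, C (w a / c) * (∑ i, ∑ j, C (G a i j) * X (Sum.inr i) * X (Sum.inr j))
      * ((∑ i, C (u a i) * X (Sum.inl i)) ^ (r + k) * (∑ i, C (u a i) * X (Sum.inl i)) ^ (r + k))
      : MvPolynomial (Fin n ⊕ Fin n) ℝ) := by
    refine IsSumSq.sum fun a _ => ((isSumSq_C (div_nonneg (hw a) hc.le)).mul
      (isSumSq_of_psd _ (fun i j => ?_) (fun z => ?_) _)).mul (IsSumSq.mul_self _)
    · simp only [G, polyHessian, Matrix.of_apply, pderiv_pderiv_comm i j]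
    · rw [← hG]
      exact hpos _ _
  unfold IsRSosConvex
  convert hsos using 1
  refine MvPolynomial.funext fun v => ?_
  obtain ⟨x, y, rfl⟩ : ∃ x y, v = Sum.elim x y :=
    ⟨v ∘ Sum.inl, v ∘ Sum.inr, (Sum.elim_comp_inl_inr v).symm⟩
  have hp : (dirDeriv y (dirDeriv y f)).IsHomogeneous (2 * k) :=
    isHomogeneous_dirDeriv (isHomogeneous_dirDeriv hf y) y
  have h1 := hker _ x hp
  rw [hcub] at h1
  · simp only [map_mul, eval_hessianBiform, map_pow, map_sum, eval_X, Sum.elim_inl, Sum.elim_inr,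
      eval_C, ← hG]
    rw [eq_comm, ← mul_right_inj' hc.ne', ← h1, Finset.mul_sum]
    refine Finset.sum_congr rfl fun a _ => ?_
    simp only [map_mul, map_pow, linForm, map_sum, eval_C, eval_X]
    have h2 : ∀ i, u a i * x i = x i * u a i := fun i => mul_comm _ _
    simp only [h2]
    field_simp
    ring
  · have h2 := (isHomogeneous_kernelInv (r := r) hp).mul
      ((isHomogeneous_linForm x).pow (2 * (r + k)))
    rw [one_mul] at h2
    exact h2.totalDegree_le

/-! ### Banach's theorem on symmetric multilinear forms -/

theorem sum_update_eq {ι E : Type*} [Fintype ι] [DecidableEq ι] [AddCommGroup E] (x : ι → E)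
    (i : ι) (v : E) : ∑ j, Function.update x i v j = ∑ j, x j - x i + v := by
  rw [Finset.sum_update_of_mem (Finset.mem_univ i), ← Finset.sum_sdiff (Finset.subset_univ {i}),
    Finset.sum_singleton]
  abel

section Banach

variable {E : Type*} [NormedAddCommGroup E] [InnerProductSpace ℝ E]

theorem norm_sq_lt_of_inner {S c : E} {a : ℝ} (ha : a ≠ 0) (hc : ‖c‖ = 1)
    (h : 0 ≤ a * inner ℝ S c) : ‖S‖ ^ 2 < ‖S + a • c‖ ^ 2 := by
  rw [norm_add_sq_real, inner_smul_right, norm_smul, hc, mul_one, Real.norm_eq_abs, sq_abs]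
  have := pow_pos (abs_pos.2 ha) 2
  rw [sq_abs] at this
  linarith

theorem MultilinearMap.continuous_of_finiteDimensional' [FiniteDimensional ℝ E] {m : ℕ}
    (F : MultilinearMap ℝ (fun _ : Fin m => E) ℝ) : Continuous F := by
  let b := Module.finBasis ℝ E
  have h : ∀ x, F x = ∑ s : Fin m → Fin (Module.finrank ℝ E),
      (∏ i, b.coord (s i) (x i)) * F fun i => b (s i) := by
    intro x
    conv_lhs => rw [show x = fun i => ∑ j, b.coord j (x i) • b j from
      funext fun i => (b.sum_repr (x i)).symm]
    rw [F.map_sum]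
    refine Finset.sum_congr rfl fun s _ => ?_
    rw [F.map_smul_univ, smul_eq_mul]
  rw [show ⇑F = _ from funext h]
  have hc : ∀ j, Continuous (b.coord j) := fun j => (b.coord j).continuous_of_finiteDimensional
  fun_prop

/-- Banach's theorem: the norm of a symmetric multilinear form on a Euclidean space is attained on
the diagonal. -/
theorem MultilinearMap.abs_le_of_diagonal [FiniteDimensional ℝ E] {m : ℕ} (hm : 1 ≤ m)
    (F : MultilinearMap ℝ (fun _ : Fin m => E) ℝ)
    (hsymm : ∀ (x : Fin m → E) (i j : Fin m), F (x ∘ Equiv.swap i j) = F x) {B : ℝ}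
    (hB : ∀ u : E, ‖u‖ = 1 → |F fun _ => u| ≤ B) (x : Fin m → E) (hx : ∀ i, ‖x i‖ = 1) :
    |F x| ≤ B := by
  have hFc : Continuous F := F.continuous_of_finiteDimensional'
  set P : Set (Fin m → E) := Set.univ.pi fun _ => Metric.sphere 0 1 with hP
  have hPc : IsCompact P := isCompact_univ_pi fun _ => isCompact_sphere 0 1
  have hPm : ∀ y, y ∈ P ↔ ∀ i, ‖y i‖ = 1 := by simp [hP]
  obtain ⟨z, hzP, hz⟩ := hPc.exists_isMaxOn ⟨x, (hPm x).2 hx⟩ hFc.abs.continuousOn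
  set l := |F z| with hl
  have hle : ∀ y ∈ P, |F y| ≤ l := fun y hy => hz hy
  have hZc : IsCompact (P ∩ {y | |F y| = l}) :=
    hPc.inter_right (isClosed_eq hFc.abs continuous_const)
  have hsc : Continuous fun y : Fin m → E => ‖∑ i, y i‖ ^ 2 := by fun_prop
  -- Among all maximisers of `|F|`, one whose sum of arguments is longest; it must be constant.
  obtain ⟨y, ⟨hyP, hyl⟩, hy⟩ := hZc.exists_isMaxOn ⟨z, hzP, rfl⟩ hsc.continuousOn
  have hy1 := (hPm y).1 hyP
  have hyl' : |F y| = l := hyl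
  have hmax : ∀ v ∈ P, |F v| = l → ‖∑ i, v i‖ ^ 2 ≤ ‖∑ i, y i‖ ^ 2 := fun v hv hvl => hy ⟨hv, hvl⟩
  have hupd : ∀ (i : Fin m) (v : Fin m → E) (c : E), v ∈ P → ‖c‖ = 1 →
      Function.update v i c ∈ P := by
    intro i v c hv hc
    rw [hPm] at hv ⊢
    intro j
    rcases eq_or_ne j i with rfl | hji
    · simpa using hc
    · simpa [hji] using hv j
  have hall : ∀ i j, y i = y j := by
    intro i j
    by_contra hne
    have hij : i ≠ j := by
      rintro rfl
      exact hne rfl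
    -- Antipodal pair: flipping one sign keeps `|F|`, so maximality forces both `y i` and `-y i` to
    -- have positive inner product with the sum.
    by_cases hneg : y i + y j = 0
    · have hj : y j = -y i := (neg_eq_of_add_eq_zero_right hneg).symm
      have hFneg : ∀ a, |F (Function.update y a (-y a))| = l := by
        intro a
        rw [← neg_one_smul ℝ (y a), F.map_update_smul, Function.update_eq_self]
        simpa using hyl'
      have key : ∀ a, ¬ 0 ≤ (-2) * inner ℝ (∑ i, y i) (y a) := by
        intro a h
        have h1 := norm_sq_lt_of_inner (by norm_num : (-2 : ℝ) ≠ 0) (hy1 a) h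
        have h2 := hmax _ (hupd a y (-y a) hyP (by rw [norm_neg, hy1])) (hFneg a)
        rw [sum_update_eq] at h2
        have h3 : ∑ i, y i - y a + -y a = ∑ i, y i + (-2 : ℝ) • y a := by module
        rw [h3] at h2
        linarith
      have h1 := key i
      have h2 := key j
      rw [hj, inner_neg_right] at h2
      linarith
    · set c := y i + y j with hc
      have hcpos : 0 < ‖c‖ := norm_pos_iff.2 hneg
      have hpar : ‖c‖ ^ 2 + ‖y i - y j‖ ^ 2 = 4 := by
        have := parallelogram_law_with_norm ℝ (y i) (y j)
        rw [hy1, hy1] at this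
        nlinarith
      have hc2 : ‖c‖ < 2 := by
        have : 0 < ‖y i - y j‖ := norm_pos_iff.2 (sub_ne_zero.2 hne)
        nlinarith
      let b : E → E → ℝ := fun a a' => F (Function.update (Function.update y i a) j a')
      have hb : b (y i) (y j) = F y := by simp [b]
      have hbs : ∀ a a', b a a' = b a' a := by
        intro a a'
        simp only [b]
        rw [← hsymm _ i j]
        congr 1
        funext t
        rcases eq_or_ne t i with rfl | hti
        · simp [hij]
        rcases eq_or_ne t j with rfl | htj
        · simp [hij]
        · simp [Equiv.swap_apply_of_ne_of_ne hti htj, hti, htj]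
      have hbr : ∀ a a' a'', b a (a' + a'') = b a a' + b a a'' := fun a a' a'' => by
        simp only [b, F.map_update_add]
      have hbl : ∀ a a' a'', b (a' + a'') a = b a' a + b a'' a := fun a a' a'' => by
        rw [hbs, hbr, hbs a a', hbs a a'']
      have hsr : ∀ t a a', b a (t • a') = t * b a a' := fun t a a' => by
        simp only [b, F.map_update_smul, smul_eq_mul]
      have hsl : ∀ t a a', b (t • a') a = t * b a' a := fun t a a' => by
        rw [hbs, hsr, hbs a a']
      have hbd : ∀ a, |b a a| ≤ l * ‖a‖ ^ 2 := by
        intro a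
        rcases eq_or_ne a 0 with rfl | ha
        · have := hsr 0 0 0
          simp at this
          simp [this]
        · have hap := norm_pos_iff.2 ha
          have h1 : ‖‖a‖⁻¹ • a‖ = 1 := by
            rw [norm_smul, norm_inv, norm_norm, inv_mul_cancel₀ hap.ne']
          have h2 := hle _ (hupd j _ _ (hupd i y _ hyP h1) h1)
          change |b (‖a‖⁻¹ • a) (‖a‖⁻¹ • a)| ≤ l at h2
          rw [hsr, hsl, abs_mul, abs_mul, abs_of_pos (inv_pos.2 hap)] at h2
          have h3 : |b a a| = ‖a‖ ^ 2 * (‖a‖⁻¹ * (‖a‖⁻¹ * |b a a|)) := by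
            field_simp
          rw [h3, mul_comm]
          gcongr
      -- Polarisation writes `b c c` as the value at `y i - y j` plus `4 * F y`; by the
      -- parallelogram law, the bound `hbd` at the difference then forces equality at `c`.
      have hcc : |b c c| = l * ‖c‖ ^ 2 := by
        refine le_antisymm (hbd c) ?_
        have h1 := abs_le.1 (hbd (y i - y j))
        have h2 : b c c = b (y i - y j) (y i - y j) + 4 * F y := by
          rw [← hb, hc, sub_eq_add_neg, ← neg_one_smul ℝ (y j)]
          simp only [hbr, hbl, hsr, hsl, hbs (y j) (y i)]
          ring
        have hpar' : ‖c‖ ^ 2 = 4 - ‖y i - y j‖ ^ 2 := by linarith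
        rcases abs_cases (F y) with ⟨h3, -⟩ | ⟨h3, -⟩ <;> rw [h3] at hyl' <;> rw [hpar', h2]
        · refine le_trans ?_ (le_abs_self _)
          nlinarith [h1.1]
        · refine le_trans ?_ (neg_le_abs _)
          nlinarith [h1.2]
      set e := ‖c‖⁻¹ • c with he
      have he1 : ‖e‖ = 1 := by rw [norm_smul, norm_inv, norm_norm, inv_mul_cancel₀ hcpos.ne']
      have hce : c = ‖c‖ • e := by rw [he, smul_smul, mul_inv_cancel₀ hcpos.ne', one_smul]
      -- Replacing both vectors by `s • e` changes the sum by `(2 * s - ‖c‖) • e`. As `‖c‖ < 2`, one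
      -- of the signs `s = ±1` lengthens it.
      have key : ∀ s : ℝ, |s| = 1 → ¬ 0 ≤ (2 * s - ‖c‖) * inner ℝ (∑ i, y i) e := by
        intro s hs h
        have hne0 : 2 * s - ‖c‖ ≠ 0 := by
          rcases abs_cases s with ⟨h3, -⟩ | ⟨h3, -⟩
          · have : 0 < 2 * s - ‖c‖ := by linarith
            exact this.ne'
          · have : 2 * s - ‖c‖ < 0 := by linarith
            exact this.ne
        have h1 := norm_sq_lt_of_inner hne0 he1 h
        have hse : ‖s • e‖ = 1 := by rw [norm_smul, he1, Real.norm_eq_abs, hs, one_mul]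
        have h2 := hmax _ (hupd j _ _ (hupd i y _ hyP hse) hse) (by
          change |b (s • e) (s • e)| = l
          rw [hsr, hsl, he, hsr, hsl, abs_mul, abs_mul, abs_mul, abs_mul, hs, hcc,
            abs_of_pos (inv_pos.2 hcpos)]
          field_simp)
        rw [sum_update_eq, sum_update_eq, Function.update_of_ne hij.symm] at h2
        have h3 : ∑ i, y i - y i + s • e - y j + s • e = ∑ i, y i + (2 * s - ‖c‖) • e := by
          rw [sub_smul, ← hce, hc]
          module
        rw [h3] at h2
        linarith
      rcases le_total 0 (inner ℝ (∑ i, y i) e) with h | h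
      · exact key 1 (by simp) (mul_nonneg (by linarith) h)
      · exact key (-1) (by simp) (mul_nonneg_of_nonpos_of_nonpos (by linarith) h)
  have hyc : y = fun _ => y ⟨0, hm⟩ := funext fun i => hall _ _
  have h1 := hB _ (hy1 ⟨0, hm⟩)
  rw [← hyc, hyl'] at h1
  exact (hle x ((hPm x).2 hx)).trans h1

end Banach

/-! ### Polarisation and bounds for iterated Laplacians -/

/-- The directional derivative as a linear function of the direction. -/
def dirDerivHom (n : ℕ) : EuclideanSpace ℝ (Fin n) →ₗ[ℝ] Module.End ℝ (MvPolynomial (Fin n) ℝ) where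
  toFun v := dirDeriv v.ofLp
  map_add' v w := LinearMap.ext fun p => dirDeriv_add v.ofLp w.ofLp p
  map_smul' c v := LinearMap.ext fun p => dirDeriv_smul c v.ofLp p

theorem dirDerivHom_apply {n : ℕ} (v : EuclideanSpace ℝ (Fin n)) (p : MvPolynomial (Fin n) ℝ) :
    dirDerivHom n v p = dirDeriv v.ofLp p := rfl

theorem commute_dirDerivHom {n : ℕ} (v w : EuclideanSpace ℝ (Fin n)) :
    Commute (dirDerivHom n v) (dirDerivHom n w) :=
  LinearMap.ext fun p => dirDeriv_comm v.ofLp w.ofLp p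

theorem eval_dirDeriv_self {n e : ℕ} {p : MvPolynomial (Fin n) ℝ} (hp : p.IsHomogeneous e)
    (x : Fin n → ℝ) : eval x (dirDeriv x p) = e * eval x p := by
  have h := congrArg (eval x) hp.sum_X_mul_pderiv
  rw [map_sum, nsmul_eq_mul] at h
  rw [dirDeriv_apply, map_sum]
  simpa [smul_eval] using h

theorem isHomogeneous_dirDerivHom_prod {n e : ℕ} {p : MvPolynomial (Fin n) ℝ}
    (hp : p.IsHomogeneous e) (l : List (EuclideanSpace ℝ (Fin n))) :
    ((l.map (dirDerivHom n)).prod p).IsHomogeneous (e - l.length) := by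
  induction l with
  | nil => simpa using hp
  | cons v l ih =>
    rw [List.map_cons, List.prod_cons, Module.End.mul_apply, dirDerivHom_apply]
    have := isHomogeneous_dirDeriv ih v.ofLp
    rwa [Nat.sub_sub, ← List.length_cons (a := v)] at this

theorem dirDerivHom_pow_eq {n e : ℕ} (x : EuclideanSpace ℝ (Fin n)) :
    ∀ p : MvPolynomial (Fin n) ℝ, p.IsHomogeneous e →
      (dirDerivHom n x ^ e) p = C (e.factorial * eval x.ofLp p) := by
  induction e with
  | zero =>
    intro p hp
    rw [← totalDegree_zero_iff_isHomogeneous, totalDegree_eq_zero_iff_eq_C] at hp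
    rw [hp]
    simp
  | succ e ih =>
    intro p hp
    rw [pow_succ, Module.End.mul_apply, dirDerivHom_apply, ih _ (isHomogeneous_dirDeriv hp _),
      eval_dirDeriv_self hp, Nat.factorial_succ]
    congr 1
    push_cast
    ring

/-- The full polarisation of a form, as a multilinear map. -/
def polarMap {n : ℕ} (m : ℕ) (q : MvPolynomial (Fin n) ℝ) :
    MultilinearMap ℝ (fun _ : Fin m => EuclideanSpace ℝ (Fin n)) ℝ :=
  ((aeval (0 : Fin n → ℝ)).toLinearMap ∘ₗ LinearMap.applyₗ q).compMultilinearMap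
    ((MultilinearMap.mkPiAlgebraFin ℝ m (Module.End ℝ (MvPolynomial (Fin n) ℝ))).compLinearMap
      fun _ => dirDerivHom n)

theorem polarMap_apply {n m : ℕ} (q : MvPolynomial (Fin n) ℝ)
    (x : Fin m → EuclideanSpace ℝ (Fin n)) :
    polarMap m q x = eval 0 ((((List.ofFn x).map (dirDerivHom n)).prod) q) := by
  simp [polarMap, List.map_ofFn, Function.comp_def, aeval_eq_eval]

/-- Banach's theorem applied to the polarisation at `l` padded with copies of `x`: differentiating a
form of degree e along `x` e times yields e! times its value at `x`. -/
theorem abs_eval_dirDerivHom_prod_le {n m : ℕ} (hm : 1 ≤ m) {q : MvPolynomial (Fin n) ℝ}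
    (hq : q.IsHomogeneous m) {B : ℝ}
    (hB : ∀ u : EuclideanSpace ℝ (Fin n), ‖u‖ = 1 → |eval u.ofLp q| ≤ B)
    {x : EuclideanSpace ℝ (Fin n)} (hx : ‖x‖ = 1) (l : List (EuclideanSpace ℝ (Fin n)))
    (hl : ∀ v ∈ l, ‖v‖ = 1) (hlm : l.length ≤ m) :
    (m - l.length).factorial * |eval x.ofLp ((l.map (dirDerivHom n)).prod q)|
      ≤ m.factorial * B := by
  have hsymm : ∀ (y : Fin m → EuclideanSpace ℝ (Fin n)) (i j : Fin m),
      polarMap m q (y ∘ Equiv.swap i j) = polarMap m q y := by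
    intro y i j
    rw [polarMap_apply, polarMap_apply]
    congr 2
    refine List.Perm.prod_eq' ((List.Perm.map _ ?_)) ?_
    · exact Equiv.Perm.ofFn_comp_perm (Equiv.swap i j) y
    · rw [List.pairwise_map]
      exact List.pairwise_of_forall fun _ _ => commute_dirDerivHom _ _
  have hdiag : ∀ u : EuclideanSpace ℝ (Fin n), ‖u‖ = 1 →
      |polarMap m q fun _ => u| ≤ m.factorial * B := by
    intro u hu
    rw [polarMap_apply, List.ofFn_const, List.map_replicate, List.prod_replicate,
      dirDerivHom_pow_eq u q hq, eval_C, abs_mul, Nat.abs_cast]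
    exact mul_le_mul_of_nonneg_left (hB u hu) (by positivity)
  obtain ⟨L, hL⟩ : ∃ L, L = List.replicate (m - l.length) x ++ l := ⟨_, rfl⟩
  have hLm : L.length = m := by simp [hL, hlm]
  have hL1 : ∀ v ∈ L, ‖v‖ = 1 := by
    intro v h
    rw [hL, List.mem_append] at h
    rcases h with h | h
    · rw [List.eq_of_mem_replicate h, hx]
    · exact hl _ h
  have hmain := MultilinearMap.abs_le_of_diagonal hm (polarMap m q) hsymm hdiag
    (fun i => L.get (i.cast hLm.symm)) fun i => hL1 _ (L.get_mem _)
  have hofn : List.ofFn (fun i : Fin m => L.get (i.cast hLm.symm)) = L := by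
    clear hmain
    subst hLm
    exact List.ofFn_get L
  rw [polarMap_apply, hofn, hL, List.map_append, List.prod_append, List.map_replicate,
    List.prod_replicate, Module.End.mul_apply,
    dirDerivHom_pow_eq x _ (isHomogeneous_dirDerivHom_prod hq l), eval_C, abs_mul,
    Nat.abs_cast] at hmain
  exact hmain

theorem polyLaplacian_eq_sum_dirDerivHom {n : ℕ} (p : MvPolynomial (Fin n) ℝ) :
    polyLaplacian n p = ∑ i, (([EuclideanSpace.single i (1 : ℝ),
      EuclideanSpace.single i (1 : ℝ)].map (dirDerivHom n)).prod p) := by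
  rw [polyLaplacian_apply]
  refine Finset.sum_congr rfl fun i _ => ?_
  have h : ∀ p, dirDerivHom n (EuclideanSpace.single i (1 : ℝ)) p = pderiv i p := fun p => by
    rw [dirDerivHom_apply, ← dirDeriv_single]
    rfl
  simp [h]

/-- The list `l` is carried for the induction: peeling off one Laplacian gives `n` terms, each with
two more unit directions. -/
theorem abs_eval_polyLaplacian_pow_le {n m : ℕ} (hm : 1 ≤ m) {q : MvPolynomial (Fin n) ℝ}
    (hq : q.IsHomogeneous m) {B : ℝ}
    (hB : ∀ u : EuclideanSpace ℝ (Fin n), ‖u‖ = 1 → |eval u.ofLp q| ≤ B)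
    {x : EuclideanSpace ℝ (Fin n)} (hx : ‖x‖ = 1) (j : ℕ) :
    ∀ l : List (EuclideanSpace ℝ (Fin n)), (∀ v ∈ l, ‖v‖ = 1) → l.length + 2 * j ≤ m →
    (m - (l.length + 2 * j)).factorial *
      |eval x.ofLp ((l.map (dirDerivHom n)).prod ((polyLaplacian n ^ j) q))|
      ≤ n ^ j * (m.factorial * B) := by
  induction j with
  | zero =>
    intro l hl hlm
    simpa using abs_eval_dirDerivHom_prod_le hm hq hB hx l hl (by omega)
  | succ j ih =>
    intro l hl hlm
    have h : eval x.ofLp ((l.map (dirDerivHom n)).prod ((polyLaplacian n ^ (j + 1)) q))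
        = ∑ i : Fin n, eval x.ofLp (((l ++ [EuclideanSpace.single i (1 : ℝ),
          EuclideanSpace.single i (1 : ℝ)]).map (dirDerivHom n)).prod ((polyLaplacian n ^ j) q)) := by
      rw [pow_succ', Module.End.mul_apply, polyLaplacian_eq_sum_dirDerivHom, map_sum, map_sum]
      refine Finset.sum_congr rfl fun i _ => ?_
      rw [List.map_append, List.prod_append, Module.End.mul_apply]
    rw [h]
    refine (mul_le_mul_of_nonneg_left (Finset.abs_sum_le_sum_abs _ _) (by positivity)).trans ?_
    rw [Finset.mul_sum]
    refine (Finset.sum_le_card_nsmul _ _ (n ^ j * (m.factorial * B)) fun i _ => ?_).trans_eq ?_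
    · have h1 := ih (l ++ [EuclideanSpace.single i (1 : ℝ), EuclideanSpace.single i (1 : ℝ)])
        (by
          intro v hv
          rw [List.mem_append] at hv
          rcases hv with hv | hv
          · exact hl v hv
          · have : v = EuclideanSpace.single i (1 : ℝ) := by simpa using hv
            simp [this])
        (by simp; omega)
      have h2 : m - (l.length + 2 * (j + 1)) = m - ((l ++ [EuclideanSpace.single i (1 : ℝ),
          EuclideanSpace.single i (1 : ℝ)]).length + 2 * j) := by
        simp
        omega
      rw [h2]
      exact h1
    · rw [Finset.card_univ, Fintype.card_fin, nsmul_eq_mul]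
      ring

/-! ### Reduction to the sphere and positivity of the kernel -/

theorem eval_smul_of_isHomogeneous {n e : ℕ} {p : MvPolynomial (Fin n) ℝ} (hp : p.IsHomogeneous e)
    (c : ℝ) (x : Fin n → ℝ) : eval (c • x) p = c ^ e * eval x p := by
  have h1 := dirDerivHom_pow_eq (WithLp.toLp 2 x) p hp
  have h2 := dirDerivHom_pow_eq (c • WithLp.toLp 2 x) p hp
  rw [map_smul, smul_pow, LinearMap.smul_apply, h1, ← C_mul', ← map_mul] at h2
  have h3 := C_injective (Fin n) ℝ h2
  have h4 : (e.factorial : ℝ) ≠ 0 := by positivity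
  simp only [WithLp.ofLp_smul] at h3
  refine mul_left_cancel₀ h4 ?_
  rw [← h3]
  ring

theorem hessianBiformAt_eq_eval {n : ℕ} (f : MvPolynomial (Fin n) ℝ)
    (x y : EuclideanSpace ℝ (Fin n)) :
    hessianBiformAt f x y = eval x.ofLp (dirDeriv y.ofLp (dirDeriv y.ofLp f)) :=
  eval_hessianBiform f _ _

theorem hessianBiformAt_smul_smul {n e : ℕ} {f : MvPolynomial (Fin n) ℝ}
    (hf : f.IsHomogeneous (e + 2)) (a b : ℝ) (x y : EuclideanSpace ℝ (Fin n)) :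
    hessianBiformAt f (a • x) (b • y) = a ^ e * b ^ 2 * hessianBiformAt f x y := by
  rw [hessianBiformAt_eq_eval, hessianBiformAt_eq_eval, WithLp.ofLp_smul, WithLp.ofLp_smul,
    eval_smul_of_isHomogeneous (isHomogeneous_dirDeriv (isHomogeneous_dirDeriv hf _) _),
    dirDeriv_smul, dirDeriv_smul, map_smul (dirDeriv _), smul_eval, smul_eval,
    show e + 2 - 1 - 1 = e by omega]
  ring

theorem exists_smul_unit {n : ℕ} (hn : 1 ≤ n) (x : EuclideanSpace ℝ (Fin n)) :
    ∃ (c : ℝ) (v : EuclideanSpace ℝ (Fin n)), ‖v‖ = 1 ∧ x = c • v := by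
  rcases eq_or_ne x 0 with rfl | hx
  · exact ⟨0, EuclideanSpace.single ⟨0, hn⟩ 1, by simp, by simp⟩
  · have := norm_pos_iff.2 hx
    refine ⟨‖x‖, ‖x‖⁻¹ • x, ?_, ?_⟩
    · rw [norm_smul, norm_inv, norm_norm, inv_mul_cancel₀ this.ne']
    · rw [smul_smul, mul_inv_cancel₀ this.ne', one_smul]

theorem isRSosConvex_of_kernelInv_nonneg_sphere {n k r : ℕ} (hn : 1 ≤ n)
    {f : MvPolynomial (Fin n) ℝ} (hf : f.IsHomogeneous (2 * k + 2))
    (hpos : ∀ u y : EuclideanSpace ℝ (Fin n), ‖u‖ = 1 → ‖y‖ = 1 →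
      0 ≤ eval u.ofLp (kernelInv n k r (dirDeriv y.ofLp (dirDeriv y.ofLp f)))) :
    IsRSosConvex r f := by
  refine isRSosConvex_of_kernelInv_nonneg hn hf fun u y => ?_
  obtain ⟨a, u', hu', hu⟩ := exists_smul_unit hn (WithLp.toLp 2 u)
  obtain ⟨b, y', hy', hy⟩ := exists_smul_unit hn (WithLp.toLp 2 y)
  have hu2 : u = a • u'.ofLp := by rw [← WithLp.ofLp_smul, ← hu]
  have hy2 : y = b • y'.ofLp := by rw [← WithLp.ofLp_smul, ← hy]
  have hh : (dirDeriv y'.ofLp (dirDeriv y'.ofLp f)).IsHomogeneous (2 * k) :=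
    isHomogeneous_dirDeriv (isHomogeneous_dirDeriv hf _) _
  rw [hu2, hy2, dirDeriv_smul, dirDeriv_smul, map_smul (dirDeriv _), map_smul (kernelInv n k r),
    map_smul (kernelInv n k r), smul_eval, smul_eval,
    eval_smul_of_isHomogeneous (isHomogeneous_kernelInv hh), pow_mul, ← mul_assoc]
  have := hpos u' y' hu' hy'
  have h2 := mul_self_nonneg b
  positivity

theorem eval_normSqPoly {n : ℕ} {u : EuclideanSpace ℝ (Fin n)} (hu : ‖u‖ = 1) :
    eval u.ofLp (normSqPoly n) = 1 := by
  rw [EuclideanSpace.norm_eq, Real.sqrt_eq_one] at hu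
  simpa [normSqPoly] using hu

theorem eval_kernelInv {n k r : ℕ} (p : MvPolynomial (Fin n) ℝ) {u : EuclideanSpace ℝ (Fin n)}
    (hu : ‖u‖ = 1) : eval u.ofLp (kernelInv n k r p)
      = ∑ j ∈ Finset.range (k + 1), invCoeff n k r j * eval u.ofLp ((polyLaplacian n ^ j) p) := by
  simp [kernelInv_apply, smul_eval, eval_normSqPoly hu]

theorem invCoeff_zero (n k r : ℕ) : invCoeff n k r 0 = 1 := by simp [invCoeff]

/-- As `j ≤ k`, every factor of the denominator is at least n + 2(r+k). -/
theorem abs_invCoeff_le {n k r j : ℕ} (hn : 1 ≤ n) (hj : j ≤ k) :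
    |invCoeff n k r j| ≤ (1 / (2 * (n + 2 * (r + k)))) ^ j / j.factorial := by
  have hn' : (1 : ℝ) ≤ n := by exact_mod_cast hn
  have hprod : ((n : ℝ) + 2 * (r + k)) ^ j
      ≤ ∏ i ∈ Finset.range j, (n + (2 * (r + 2 * k - j) : ℕ) + 2 * i : ℝ) := by
    have h := Finset.prod_le_prod (s := Finset.range j) (f := fun _ => (n : ℝ) + 2 * (r + k))
      (g := fun i : ℕ => (n + (2 * (r + 2 * k - j) : ℕ) + 2 * i : ℝ)) (fun i _ => by positivity)
      fun i _ => by
        have h1 : ((r + k : ℕ) : ℝ) ≤ (r + 2 * k - j : ℕ) := by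
          exact_mod_cast (by omega : r + k ≤ r + 2 * k - j)
        push_cast at h1 ⊢
        have : (0 : ℝ) ≤ i := by positivity
        linarith
    simpa using h
  have h0 : (0 : ℝ) < (n + 2 * (r + k)) ^ j := by positivity
  rw [invCoeff, abs_div, abs_div, abs_pow, abs_neg, abs_of_pos (h0.trans_le hprod), Nat.abs_cast,
    abs_of_pos (by norm_num : (0 : ℝ) < 1 / 2), div_right_comm]
  refine div_le_div_of_nonneg_right ?_ (by positivity)
  rw [one_div, one_div, mul_inv, mul_pow, div_eq_mul_inv, inv_pow ((n : ℝ) + 2 * (r + k))]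
  refine mul_le_mul_of_nonneg_left ?_ (by positivity)
  exact inv_anti₀ h0 hprod

theorem factorial_le_pow_mul_factorial {k j : ℕ} (hj : j ≤ k) :
    (2 * k).factorial ≤ (2 * k * (2 * k - 1)) ^ j * (2 * k - 2 * j).factorial := by
  induction j with
  | zero => simp
  | succ j ih =>
    refine (ih (by omega)).trans ?_
    obtain ⟨c, hc⟩ : ∃ c, 2 * k - 2 * j = c + 2 := ⟨2 * k - 2 * (j + 1), by omega⟩
    have h1 : (c + 1 + 1) * (c + 1) ≤ 2 * k * (2 * k - 1) := Nat.mul_le_mul (by omega) (by omega)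
    generalize 2 * k * (2 * k - 1) = K at h1
    rw [hc, show 2 * k - 2 * (j + 1) = c by omega, pow_succ, mul_assoc, Nat.factorial_succ,
      Nat.factorial_succ, ← mul_assoc (c + 1 + 1)]
    gcongr

/-- With `a` the argument of the exponential, the term of index j ≥ 1 is at most M a^j/j!, so all of
them together cost at most M(e^a - 1) ≤ μ. -/
theorem kernelInv_nonneg_of_exp_le {n k r : ℕ} (hn : 1 ≤ n) (hk : 1 ≤ k)
    {p : MvPolynomial (Fin n) ℝ} (hp : p.IsHomogeneous (2 * k)) {μ M : ℝ} (hμ : 0 < μ)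
    (hpμ : ∀ u : EuclideanSpace ℝ (Fin n), ‖u‖ = 1 → μ ≤ eval u.ofLp p)
    (hpM : ∀ u : EuclideanSpace ℝ (Fin n), ‖u‖ = 1 → eval u.ofLp p ≤ M)
    (hexp : M * (Real.exp (n * (2 * k * (2 * k - 1)) / (2 * (n + 2 * (r + k)))) - 1) ≤ μ)
    {u : EuclideanSpace ℝ (Fin n)} (hu : ‖u‖ = 1) :
    0 ≤ eval u.ofLp (kernelInv n k r p) := by
  have hn' : (1 : ℝ) ≤ n := by exact_mod_cast hn
  have hk' : (1 : ℝ) ≤ k := by exact_mod_cast hk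
  have hM : 0 < M := hμ.trans_le ((hpμ u hu).trans (hpM u hu))
  set a : ℝ := n * (2 * k * (2 * k - 1)) / (2 * (n + 2 * (r + k))) with ha
  have ha0 : 0 ≤ a := by
    have : (0 : ℝ) ≤ 2 * k - 1 := by linarith
    positivity
  have hterm : ∀ j ∈ Finset.range k,
      |invCoeff n k r (j + 1) * eval u.ofLp ((polyLaplacian n ^ (j + 1)) p)|
        ≤ M * (a ^ (j + 1) / (j + 1).factorial) := by
    intro j hj
    have hj' : j + 1 ≤ k := Finset.mem_range.1 hj
    generalize j + 1 = i at hj'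
    have h1 := abs_eval_polyLaplacian_pow_le (by omega) hp (B := M) (fun v hv => by
      rw [abs_of_pos (hμ.trans_le (hpμ v hv))]
      exact hpM v hv) hu i [] (by simp) (by simp; omega)
    simp only [List.length_nil, zero_add, List.map_nil, List.prod_nil, Module.End.one_apply] at h1
    have h2 : ((2 * k).factorial : ℝ)
        ≤ (2 * k * (2 * k - 1)) ^ i * (2 * k - 2 * i).factorial := by
      have := factorial_le_pow_mul_factorial hj'
      have h3 : ((2 * k - 1 : ℕ) : ℝ) = 2 * k - 1 := by
        rw [Nat.cast_sub (by omega)]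
        push_cast
        ring
      rw [← h3]
      exact_mod_cast this
    have h3 : |eval u.ofLp ((polyLaplacian n ^ i) p)| ≤ (n * (2 * k * (2 * k - 1))) ^ i * M := by
      have h4 : (0 : ℝ) < (2 * k - 2 * i).factorial := by positivity
      refine le_of_mul_le_mul_left (h1.trans ?_) h4
      calc (n : ℝ) ^ i * ((2 * k).factorial * M)
          ≤ n ^ i * ((2 * k * (2 * k - 1)) ^ i * (2 * k - 2 * i).factorial * M) := by gcongr
        _ = _ := by
          rw [mul_pow (n : ℝ)]
          ring
    rw [abs_mul]
    refine (mul_le_mul (abs_invCoeff_le hn hj') h3 (abs_nonneg _) (by positivity)).trans_eq ?_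
    rw [ha, div_pow, div_pow, one_pow]
    field_simp
  have hsum := (Finset.abs_sum_le_sum_abs _ _).trans (Finset.sum_le_sum hterm)
  rw [← Finset.mul_sum] at hsum
  have hexp2 := Real.sum_le_exp_of_nonneg ha0 (k + 1)
  rw [Finset.sum_range_succ'] at hexp2
  simp only [pow_zero, Nat.factorial_zero, Nat.cast_one, div_one] at hexp2
  have h5 : M * ∑ j ∈ Finset.range k, a ^ (j + 1) / (j + 1).factorial ≤ μ :=
    (mul_le_mul_of_nonneg_left (by linarith) hM.le).trans hexp
  rw [eval_kernelInv p hu, Finset.sum_range_succ', invCoeff_zero, one_mul, pow_zero,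
    Module.End.one_apply]
  have h6 := (abs_le.1 hsum).1
  have h7 := hpμ u hu
  linarith

/-! ### The lower bound for M/μ and the case d ≥ 6 -/

theorem hasDerivAt_eval_line {n : ℕ} (x v : Fin n → ℝ) (p : MvPolynomial (Fin n) ℝ) (t : ℝ) :
    HasDerivAt (fun t : ℝ => eval (x + t • v) p) (eval (x + t • v) (dirDeriv v p)) t := by
  induction p using MvPolynomial.induction_on with
  | C a => simpa [dirDeriv_apply] using hasDerivAt_const t a
  | add p q hp hq => simpa using hp.fun_add hq
  | mul_X p i hp =>
    have h1 : HasDerivAt (fun t : ℝ => x i + t * v i) (v i) t := by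
      simpa using ((hasDerivAt_id t).mul_const (v i)).const_add (x i)
    have h2 := hp.fun_mul h1
    have h3 : dirDeriv v (p * X i) = dirDeriv v p * X i + p * C (v i) := by
      simp only [dirDeriv_apply, pderiv_mul, smul_add, Finset.sum_add_distrib, Finset.sum_mul,
        smul_mul_assoc]
      congr 1
      rw [Finset.sum_eq_single i]
      · rw [pderiv_X_self, MvPolynomial.smul_eq_C_mul]
        ring
      · intro j _ hj
        rw [pderiv_X_of_ne hj.symm]
        simp
      · simp
    rw [h3]
    simpa using h2

/-- If `b < 0`, the second derivative test makes 0 a local maximum too; then `g` is locally constant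
and `b = 0`. -/
theorem second_deriv_nonneg_of_isMin {g g' : ℝ → ℝ} {b : ℝ} (hg : ∀ t, HasDerivAt g (g' t) t)
    (hg' : HasDerivAt g' b 0) (hmin : ∀ t, g 0 ≤ g t) : 0 ≤ b := by
  by_contra! hb
  have hd : deriv g = g' := funext fun t => (hg t).deriv
  have hlmin : IsLocalMin g 0 := Filter.Eventually.of_forall hmin
  have hlmax : IsLocalMax g 0 := isLocalMax_of_deriv_deriv_neg (by rwa [hd, hg'.deriv])
    hlmin.deriv_eq_zero (hg 0).continuousAt
  have he : g =ᶠ[nhds 0] fun _ => g 0 := by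
    filter_upwards [hlmax] with t ht
    exact le_antisymm ht (hmin t)
  have h1 := he.deriv.deriv_eq
  rw [hd, hg'.deriv] at h1
  simp at h1
  linarith

/-- Let `x` maximise `f` on the sphere, with value F, and let `v` be a unit vector orthogonal to
`x`. Then F(1+t²)^(k+1) - f(x+tv) is minimal at t = 0, so its second derivative gives μ ≤ 2(k+1)F.
Euler's identity gives (2k+2)(2k+1)F ≤ M. -/
theorem mul_le_of_bisphere_bounds {n k : ℕ} (hn : 2 ≤ n) {f : MvPolynomial (Fin n) ℝ}
    (hf : f.IsHomogeneous (2 * k + 2)) {μ M : ℝ}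
    (hμ : ∀ x y : EuclideanSpace ℝ (Fin n), ‖x‖ = 1 → ‖y‖ = 1 → μ ≤ hessianBiformAt f x y)
    (hM : ∀ x y : EuclideanSpace ℝ (Fin n), ‖x‖ = 1 → ‖y‖ = 1 → hessianBiformAt f x y ≤ M) :
    (2 * k + 1) * μ ≤ M := by
  have hc : Continuous fun x : EuclideanSpace ℝ (Fin n) => eval x.ofLp f :=
    (MvPolynomial.continuous_eval f).comp (by fun_prop)
  obtain ⟨x, hx, hmax⟩ := (isCompact_sphere (0 : EuclideanSpace ℝ (Fin n)) 1).exists_isMaxOn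
    ⟨EuclideanSpace.single ⟨0, by omega⟩ 1, by simp⟩ hc.continuousOn
  have hx1 : ‖x‖ = 1 := by simpa using hx
  obtain ⟨v, hv1, hxv⟩ : ∃ v : EuclideanSpace ℝ (Fin n), ‖v‖ = 1 ∧ inner ℝ x v = 0 := by
    have : Nontrivial (ℝ ∙ x)ᗮ := by
      have h1 : Module.finrank ℝ (ℝ ∙ x)ᗮ + Module.finrank ℝ (ℝ ∙ x) = n := by
        rw [add_comm, Submodule.finrank_add_finrank_orthogonal, finrank_euclideanSpace_fin]
      have h2 : Module.finrank ℝ (ℝ ∙ x) ≤ 1 := by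
        simpa using finrank_span_le_card (R := ℝ) ({x} : Set (EuclideanSpace ℝ (Fin n)))
      exact Module.nontrivial_of_finrank_pos (R := ℝ) (by omega)
    obtain ⟨w, hw⟩ := exists_ne (0 : (ℝ ∙ x)ᗮ)
    have hw0 : 0 < ‖(w : EuclideanSpace ℝ (Fin n))‖ := norm_pos_iff.2 (by simpa using hw)
    refine ⟨‖(w : EuclideanSpace ℝ (Fin n))‖⁻¹ • (w : EuclideanSpace ℝ (Fin n)), ?_, ?_⟩
    · rw [norm_smul, norm_inv, norm_norm, inv_mul_cancel₀ hw0.ne']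
    · rw [inner_smul_right, Submodule.mem_orthogonal_singleton_iff_inner_right.1 w.2, mul_zero]
  set F := eval x.ofLp f with hF
  have hle : ∀ t : ℝ, eval (x.ofLp + t • v.ofLp) f ≤ F * (1 + t ^ 2) ^ (k + 1) := by
    intro t
    obtain ⟨c, w, hw, hcw⟩ := exists_smul_unit (by omega) (x + t • v)
    have h1 : ‖x + t • v‖ ^ 2 = 1 + t ^ 2 := by
      rw [norm_add_sq_real, inner_smul_right, hxv, norm_smul, hx1, hv1]
      simp
    have h2 : c ^ 2 = 1 + t ^ 2 := by rw [← h1, hcw, norm_smul, hw, mul_one, Real.norm_eq_abs, sq_abs]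
    have h3 : x.ofLp + t • v.ofLp = c • w.ofLp := by
      rw [← WithLp.ofLp_smul, ← WithLp.ofLp_add, hcw, WithLp.ofLp_smul]
    have h4 : eval w.ofLp f ≤ F := hmax (by simpa using hw)
    rw [h3, eval_smul_of_isHomogeneous hf, show 2 * k + 2 = 2 * (k + 1) by ring, pow_mul, h2, mul_comm]
    exact mul_le_mul_of_nonneg_right h4 (by positivity)
  have hd1 : ∀ t : ℝ, HasDerivAt (fun t : ℝ => F * (1 + t ^ 2) ^ (k + 1)
      - eval (x.ofLp + t • v.ofLp) f) (F * ((k + 1) * (1 + t ^ 2) ^ k * (2 * t))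
      - eval (x.ofLp + t • v.ofLp) (dirDeriv v.ofLp f)) t := by
    intro t
    refine HasDerivAt.sub (HasDerivAt.const_mul F ?_) (hasDerivAt_eval_line _ _ _ _)
    have h1 : HasDerivAt (fun t : ℝ => 1 + t ^ 2) (2 * t) t := by
      simpa using (hasDerivAt_pow 2 t).const_add (1 : ℝ)
    simpa using h1.fun_pow (k + 1)
  have hd2 : HasDerivAt (fun t : ℝ => F * ((k + 1) * (1 + t ^ 2) ^ k * (2 * t))
      - eval (x.ofLp + t • v.ofLp) (dirDeriv v.ofLp f))
      (F * ((k + 1) * 2) - hessianBiformAt f x v) 0 := by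
    rw [hessianBiformAt_eq_eval]
    have h2 := hasDerivAt_eval_line x.ofLp v.ofLp (dirDeriv v.ofLp f) 0
    rw [zero_smul, add_zero] at h2
    refine HasDerivAt.sub (HasDerivAt.const_mul F ?_) h2
    have h1 : HasDerivAt (fun t : ℝ => 1 + t ^ 2) (2 * 0) 0 := by
      simpa using (hasDerivAt_pow 2 (0 : ℝ)).const_add (1 : ℝ)
    have h3 := ((h1.fun_pow k).const_mul ((k : ℝ) + 1)).fun_mul ((hasDerivAt_id (0 : ℝ)).const_mul (2 : ℝ))
    simpa using h3
  have hsec := second_deriv_nonneg_of_isMin hd1 hd2 fun t => by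
    have := hle t
    simp only [zero_smul, add_zero, ← hF]
    norm_num
    exact this
  have h1 := hμ x v hx1 hv1
  have h2 := hM x x hx1 hx1
  rw [hessianBiformAt_eq_eval, eval_dirDeriv_self (isHomogeneous_dirDeriv hf _),
    eval_dirDeriv_self hf, ← hF] at h2
  push_cast [show 2 * k + 2 - 1 = 2 * k + 1 by omega] at h2
  have h3 : (2 * k + 1) * μ ≤ (2 * k + 1) * (F * ((k + 1) * 2)) :=
    mul_le_mul_of_nonneg_left (by linarith) (by positivity)
  linarith

/-- Here `t` is M/μ and `A` is n/2 + r + k. The bound log(1+1/t) ≥ 2/(2t+1) is much better than log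
2/t for large `t`; the difference absorbs the loss `2 * k + 2`. -/
theorem exp_sub_one_le_of_bound {k n A t : ℝ} (hk : 2 ≤ k) (hn : 2 ≤ n) (ht : 2 * k + 1 ≤ t)
    (hA : n * (2 * k) * (2 * k - 1) / (4 * Real.log 2) * t - 2 * k - 2 ≤ A) :
    Real.exp (n * (2 * k * (2 * k - 1)) / (4 * A)) - 1 ≤ 1 / t := by
  set W := n * (2 * k * (2 * k - 1)) with hW
  have ht0 : 0 < t := by linarith
  have hl0 : 0 < Real.log 2 := Real.log_pos (by norm_num)
  have hl : (1.44 : ℝ) ≤ 1 / Real.log 2 := by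
    rw [le_div_iff₀ hl0]
    linarith [Real.log_two_lt_d9]
  have hWk : 12 * k ≤ W := by
    have h1 : 2 * (2 * k * (2 * k - 1)) ≤ W := mul_le_mul_of_nonneg_right hn (by nlinarith)
    nlinarith
  have hW0 : 0 < W := by linarith
  have hA2 : W * t * (1.44 : ℝ) / 4 - 2 * k - 2 ≤ A := by
    have h1 : n * (2 * k) * (2 * k - 1) / (4 * Real.log 2) * t = W * t / 4 * (1 / Real.log 2) := by
      rw [hW]
      field_simp
    rw [h1] at hA
    have h2 : W * t / 4 * (1.44 : ℝ) ≤ W * t / 4 * (1 / Real.log 2) :=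
      mul_le_mul_of_nonneg_left hl (by positivity)
    linarith
  have hkey : W * (2 * t + 1) ≤ 8 * A := by
    -- 0.88 = 2·1.44 - 2, and `t ≥ 5`. What remains is 3.4·12k ≥ 16k + 16.
    have h1 : W * (3.4 : ℝ) ≤ W * (0.88 * t - 1) :=
      mul_le_mul_of_nonneg_left (by linarith) hW0.le
    nlinarith
  have hA0 : 0 < A := by
    have : 0 < W * (2 * t + 1) := by positivity
    linarith
  have hlog := Real.le_log_one_add_of_nonneg (x := 1 / t) (by positivity)
  have h2 : W / (4 * A) ≤ Real.log (1 + 1 / t) := by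
    refine le_trans ?_ hlog
    have : 2 * (1 / t) / (1 / t + 2) = 2 / (2 * t + 1) := by
      field_simp
      ring
    rw [this, div_le_div_iff₀ (by positivity) (by positivity)]
    linarith
  have h3 := Real.exp_le_exp.2 h2
  rw [Real.exp_log (by positivity)] at h3
  linarith

theorem isRSosConvex_of_two_le {n k r : ℕ} (hn : 2 ≤ n) (hk : 2 ≤ k) {f : MvPolynomial (Fin n) ℝ}
    (hf : f.IsHomogeneous (2 * k + 2)) {μ M : ℝ} (hμ0 : 0 < μ)
    (hμ : ∀ x y : EuclideanSpace ℝ (Fin n), ‖x‖ = 1 → ‖y‖ = 1 → μ ≤ hessianBiformAt f x y)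
    (hM : ∀ x y : EuclideanSpace ℝ (Fin n), ‖x‖ = 1 → ‖y‖ = 1 → hessianBiformAt f x y ≤ M)
    (hr : (n * (2 * k) * (2 * k - 1) / (4 * Real.log 2) * (M / μ) - 2 * k - 2 : ℝ)
      ≤ n / 2 + r + k) :
    IsRSosConvex r f := by
  refine isRSosConvex_of_kernelInv_nonneg_sphere (by omega) hf fun u y hu hy => ?_
  have hMμ := mul_le_of_bisphere_bounds hn hf hμ hM
  have hk' : (2 : ℝ) ≤ k := by exact_mod_cast hk
  have hn' : (2 : ℝ) ≤ n := by exact_mod_cast hn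
  have hexp := exp_sub_one_le_of_bound hk' hn' ((le_div_iff₀ hμ0).2 hMμ) hr
  have hM0 : 0 < M := hμ0.trans_le ((hμ u y hu hy).trans (hM u y hu hy))
  refine kernelInv_nonneg_of_exp_le (by omega) (by omega)
    (isHomogeneous_dirDeriv (isHomogeneous_dirDeriv hf _) _) hμ0 (M := M) (fun v hv => ?_)
    (fun v hv => ?_) ?_ hu
  · rw [← hessianBiformAt_eq_eval]
    exact hμ v y hv hy
  · rw [← hessianBiformAt_eq_eval]
    exact hM v y hv hy
  · rw [show (2 : ℝ) * (n + 2 * (r + k)) = 4 * (n / 2 + r + k) by ring]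
    refine (mul_le_mul_of_nonneg_left hexp hM0.le).trans_eq ?_
    field_simp

/-! ### Quadratic forms and one variable -/

theorem isRSosConvex_of_quadratic {n r : ℕ} (hn : 1 ≤ n) {f : MvPolynomial (Fin n) ℝ}
    (hf : f.IsHomogeneous 2)
    (hpos : ∀ x y : EuclideanSpace ℝ (Fin n), ‖x‖ = 1 → ‖y‖ = 1 → 0 ≤ hessianBiformAt f x y) :
    IsRSosConvex r f := by
  refine isRSosConvex_of_kernelInv_nonneg_sphere (k := 0) hn hf fun u y hu hy => ?_
  rw [eval_kernelInv _ hu]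
  simpa [invCoeff_zero, hessianBiformAt_eq_eval] using hpos u y hu hy

theorem IsRSosConvex.of_zero {n : ℕ} {f : MvPolynomial (Fin n) ℝ} (h : IsRSosConvex 0 f) (r : ℕ) :
    IsRSosConvex r f := by
  have h2 : IsSumSq ((∑ i, X (Sum.inl i) ^ 2 : MvPolynomial (Fin n ⊕ Fin n) ℝ) ^ r) := by
    have h3 := IsSumSq.prod (I := Finset.range r) fun _ _ =>
      IsSumSq.sum_sq Finset.univ fun i => (X (Sum.inl i) : MvPolynomial (Fin n ⊕ Fin n) ℝ)
    simpa using h3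
  unfold IsRSosConvex at h ⊢
  rw [pow_zero, mul_one] at h
  exact h.mul h2

theorem isRSosConvex_of_univariate {k r : ℕ} {f : MvPolynomial (Fin 1) ℝ}
    (hf : f.IsHomogeneous (2 * k + 2))
    (hpos : ∀ x y : EuclideanSpace ℝ (Fin 1), ‖x‖ = 1 → ‖y‖ = 1 → 0 ≤ hessianBiformAt f x y) :
    IsRSosConvex r f := by
  refine IsRSosConvex.of_zero ?_ r
  set e : EuclideanSpace ℝ (Fin 1) := EuclideanSpace.single 0 1 with he
  have he1 : ‖e‖ = 1 := by simp [he]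
  have h := (isSumSq_C (σ := Fin 1 ⊕ Fin 1) (hpos e e he1 he1)).mul
    (IsSumSq.mul_self (X (Sum.inl 0) ^ k * X (Sum.inr 0) : MvPolynomial (Fin 1 ⊕ Fin 1) ℝ))
  suffices hh : hessianBiform f = C (hessianBiformAt f e e)
      * (X (Sum.inl 0) ^ k * X (Sum.inr 0) * (X (Sum.inl 0) ^ k * X (Sum.inr 0))) by
    unfold IsRSosConvex
    rw [pow_zero, mul_one, hh]
    exact h
  refine MvPolynomial.funext fun v => ?_
  have hv : ∀ t : ℝ, (t • e).ofLp = fun _ => t := fun t => by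
    funext i
    simp [he, Subsingleton.elim i 0]
  have h1 := hessianBiformAt_smul_smul hf (v (Sum.inl 0)) (v (Sum.inr 0)) e e
  have h2 : Sum.elim (v (Sum.inl 0) • e).ofLp (v (Sum.inr 0) • e).ofLp = v := by
    rw [hv, hv]
    funext i
    rcases i with i | i <;> simp [Subsingleton.elim i 0]
  rw [hessianBiformAt, h2] at h1
  rw [h1]
  simp
  ring

/-! ### Quartics: a sharp bound on the Laplacian -/

theorem dirDeriv_sub {n : ℕ} (v w : Fin n → ℝ) (p : MvPolynomial (Fin n) ℝ) :
    dirDeriv (v - w) p = dirDeriv v p - dirDeriv w p := by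
  rw [sub_eq_add_neg, ← neg_one_smul ℝ w, dirDeriv_add, dirDeriv_smul, neg_one_smul,
    ← sub_eq_add_neg]

/-- The fourth derivatives of a polynomial at the origin, as a quadrilinear form. -/
def quartForm {n : ℕ} (f : MvPolynomial (Fin n) ℝ) (a b c d : Fin n → ℝ) : ℝ :=
  eval 0 (dirDeriv a (dirDeriv b (dirDeriv c (dirDeriv d f))))

theorem quartForm_self {n : ℕ} {f : MvPolynomial (Fin n) ℝ} (hf : f.IsHomogeneous 4)
    (x y : EuclideanSpace ℝ (Fin n)) :
    quartForm f x.ofLp x.ofLp y.ofLp y.ofLp = 2 * hessianBiformAt f x y := by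
  have h := dirDerivHom_pow_eq (e := 2) x _
    (isHomogeneous_dirDeriv (isHomogeneous_dirDeriv hf y.ofLp) y.ofLp)
  rw [hessianBiformAt_eq_eval, quartForm, ← dirDerivHom_apply, ← dirDerivHom_apply x,
    ← Module.End.mul_apply, ← pow_two, h, eval_C]
  simp

theorem quartForm_add_sub {n : ℕ} (f : MvPolynomial (Fin n) ℝ) (a b : Fin n → ℝ) :
    quartForm f (a + b) (a + b) (a - b) (a - b)
      = quartForm f a a a a + quartForm f b b b b - 2 * quartForm f a a b b := by
  simp only [quartForm, dirDeriv_add, dirDeriv_sub, map_add, map_sub, dirDeriv_comm b a]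
  ring

/-- Full symmetry of the fourth derivatives lets a value of the Hessian form control a mixed value
from above. -/
theorem hessianBiformAt_add_sub {n : ℕ} {f : MvPolynomial (Fin n) ℝ} (hf : f.IsHomogeneous 4)
    (a b : EuclideanSpace ℝ (Fin n)) :
    hessianBiformAt f (a + b) (a - b)
      = hessianBiformAt f a a + hessianBiformAt f b b - 2 * hessianBiformAt f a b := by
  have h := quartForm_add_sub f a.ofLp b.ofLp
  rw [← WithLp.ofLp_add, ← WithLp.ofLp_sub] at h
  simp only [quartForm_self hf] at h
  linarith

theorem hessianBiformAt_ge {n e : ℕ} (hn : 1 ≤ n) {f : MvPolynomial (Fin n) ℝ}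
    (hf : f.IsHomogeneous (2 * e + 2)) {μ : ℝ}
    (hμ : ∀ x y : EuclideanSpace ℝ (Fin n), ‖x‖ = 1 → ‖y‖ = 1 → μ ≤ hessianBiformAt f x y)
    (x y : EuclideanSpace ℝ (Fin n)) :
    μ * ((‖x‖ ^ 2) ^ e * ‖y‖ ^ 2) ≤ hessianBiformAt f x y := by
  obtain ⟨a, u, hu, rfl⟩ := exists_smul_unit hn x
  obtain ⟨b, v, hv, rfl⟩ := exists_smul_unit hn y
  rw [hessianBiformAt_smul_smul hf, norm_smul, norm_smul, hu, hv, mul_one, mul_one,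
    Real.norm_eq_abs, Real.norm_eq_abs, sq_abs, sq_abs, mul_comm, pow_mul]
  exact mul_le_mul_of_nonneg_left (hμ u v hu hv) (by positivity)

theorem orthonormal_bound {n : ℕ} (hn : 1 ≤ n) {f : MvPolynomial (Fin n) ℝ}
    (hf : f.IsHomogeneous 4) {μ : ℝ}
    (hμ : ∀ x y : EuclideanSpace ℝ (Fin n), ‖x‖ = 1 → ‖y‖ = 1 → μ ≤ hessianBiformAt f x y)
    {u v : EuclideanSpace ℝ (Fin n)} (hu : ‖u‖ = 1) (hv : ‖v‖ = 1) (huv : inner ℝ u v = 0) :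
    2 * hessianBiformAt f u v + 4 * μ ≤ hessianBiformAt f u u + hessianBiformAt f v v := by
  have h := hessianBiformAt_ge (e := 1) hn hf hμ (u + v) (u - v)
  rw [norm_add_sq_real, norm_sub_sq_real, huv, hu, hv, hessianBiformAt_add_sub hf] at h
  linarith

/-- Split each basis vector into its part along `y` and a rest `w i` orthogonal to `y`. The parts
along `y` and the cross terms add up to the value at `y, y, y, y`; the `w i` have total squared
length n - 1, and `orthonormal_bound` gives M - 2μ in their directions. -/
theorem sum_quartForm_single_le {n : ℕ} (hn : 1 ≤ n) {f : MvPolynomial (Fin n) ℝ}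
    (hf : f.IsHomogeneous 4) {μ M : ℝ}
    (hμ : ∀ x y : EuclideanSpace ℝ (Fin n), ‖x‖ = 1 → ‖y‖ = 1 → μ ≤ hessianBiformAt f x y)
    (hM : ∀ x y : EuclideanSpace ℝ (Fin n), ‖x‖ = 1 → ‖y‖ = 1 → hessianBiformAt f x y ≤ M)
    {y : EuclideanSpace ℝ (Fin n)} (hy : ‖y‖ = 1) :
    ∑ i, quartForm f (Pi.single i 1) (Pi.single i 1) y.ofLp y.ofLp
      ≤ 2 * (M + (n - 1) * (M - 2 * μ)) := by
  have hy2 : ∑ i, y i ^ 2 = 1 := by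
    rw [EuclideanSpace.norm_eq, Real.sqrt_eq_one] at hy
    simpa using hy
  let w : Fin n → EuclideanSpace ℝ (Fin n) := fun i => EuclideanSpace.single i 1 - y i • y
  have hwy : ∀ i, inner ℝ (w i) y = 0 := fun i => by
    simp [w, inner_sub_left, inner_smul_left, hy, EuclideanSpace.inner_single_left]
  have hw2 : ∀ i, ‖w i‖ ^ 2 = 1 - y i ^ 2 := fun i => by
    simp only [w]
    rw [norm_sub_sq_real, inner_smul_right, EuclideanSpace.inner_single_left, norm_smul, hy]
    simp
    ring
  have hww : ∀ i, quartForm f (w i).ofLp (w i).ofLp y.ofLp y.ofLp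
      ≤ 2 * ((M - 2 * μ) * ‖w i‖ ^ 2) := by
    intro i
    rw [quartForm_self hf]
    rcases eq_or_ne (w i) 0 with h0 | h0
    · have := hessianBiformAt_smul_smul (e := 2) hf 0 1 y y
      simp at this
      simp [h0, this]
    · have hp := norm_pos_iff.2 h0
      set v := ‖w i‖⁻¹ • w i with hv
      have hv1 : ‖v‖ = 1 := by rw [norm_smul, norm_inv, norm_norm, inv_mul_cancel₀ hp.ne']
      have hwv : w i = ‖w i‖ • v := by rw [hv, smul_smul, mul_inv_cancel₀ hp.ne', one_smul]
      have h1 := orthonormal_bound hn hf hμ hv1 hy (by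
        rw [hv, inner_smul_left, hwy, mul_zero])
      have h2 := hessianBiformAt_smul_smul (e := 2) hf ‖w i‖ 1 v y
      rw [← hwv, one_smul, one_pow, mul_one] at h2
      have h3 := hM v v hv1 hv1
      have h4 := hM y y hy hy
      rw [h2, mul_comm (M - 2 * μ)]
      have : ‖w i‖ ^ 2 * hessianBiformAt f v y ≤ ‖w i‖ ^ 2 * (M - 2 * μ) :=
        mul_le_mul_of_nonneg_left (by linarith) (by positivity)
      linarith
  have hexp : ∀ i, quartForm f (Pi.single i 1) (Pi.single i 1) y.ofLp y.ofLp
      = 2 * y i * quartForm f (Pi.single i 1) y.ofLp y.ofLp y.ofLp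
        - y i ^ 2 * quartForm f y.ofLp y.ofLp y.ofLp y.ofLp
        + quartForm f (w i).ofLp (w i).ofLp y.ofLp y.ofLp := by
    intro i
    have : (w i).ofLp = Pi.single i 1 - y i • y.ofLp := rfl
    rw [this]
    simp only [quartForm, dirDeriv_sub, dirDeriv_smul, map_sub, map_smul, smul_eval,
      dirDeriv_comm y.ofLp (Pi.single i 1)]
    ring
  have hlin : ∑ i, y i * quartForm f (Pi.single i 1) y.ofLp y.ofLp y.ofLp
      = quartForm f y.ofLp y.ofLp y.ofLp y.ofLp := by
    simp only [quartForm, dirDeriv_single]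
    rw [dirDeriv_apply y.ofLp (dirDeriv y.ofLp (dirDeriv y.ofLp (dirDeriv y.ofLp f))), map_sum]
    simp
  have hsum : ∑ i, quartForm f (Pi.single i 1) (Pi.single i 1) y.ofLp y.ofLp
      = quartForm f y.ofLp y.ofLp y.ofLp y.ofLp
        + ∑ i, quartForm f (w i).ofLp (w i).ofLp y.ofLp y.ofLp := by
    rw [Finset.sum_congr rfl fun i _ => hexp i, Finset.sum_add_distrib, Finset.sum_sub_distrib,
      ← Finset.sum_mul, hy2]
    simp only [mul_assoc]
    rw [← Finset.mul_sum, hlin]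
    ring
  have h1 := Finset.sum_le_sum fun i (_ : i ∈ Finset.univ) => hww i
  rw [← Finset.mul_sum, ← Finset.mul_sum, Finset.sum_congr rfl fun i _ => hw2 i,
    Finset.sum_sub_distrib, hy2] at h1
  simp only [Finset.sum_const, Finset.card_univ, Fintype.card_fin, nsmul_eq_mul, mul_one] at h1
  have h2 := hM y y hy hy
  rw [hsum, quartForm_self hf]
  linarith

/-- For k = 1 the kernel on the sphere is p - Δp/(2(n+2(r+1))), with Δp constant. -/
theorem isRSosConvex_quartic_of_le {n r : ℕ} (hn : 1 ≤ n) {f : MvPolynomial (Fin n) ℝ}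
    (hf : f.IsHomogeneous 4) {μ M : ℝ}
    (hμ : ∀ x y : EuclideanSpace ℝ (Fin n), ‖x‖ = 1 → ‖y‖ = 1 → μ ≤ hessianBiformAt f x y)
    (hM : ∀ x y : EuclideanSpace ℝ (Fin n), ‖x‖ = 1 → ‖y‖ = 1 → hessianBiformAt f x y ≤ M)
    (hr : M + (n - 1) * (M - 2 * μ) ≤ (n + 2 * (r + 1)) * μ) :
    IsRSosConvex r f := by
  refine isRSosConvex_of_kernelInv_nonneg_sphere (k := 1) hn hf fun u y hu hy => ?_
  have hn' : (1 : ℝ) ≤ n := by exact_mod_cast hn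
  have h2 : eval u.ofLp (polyLaplacian n (dirDeriv y.ofLp (dirDeriv y.ofLp f)))
      = ∑ i, quartForm f (Pi.single i 1) (Pi.single i 1) y.ofLp y.ofLp := by
    rw [polyLaplacian_apply, map_sum]
    refine Finset.sum_congr rfl fun i _ => ?_
    have h3 : (pderiv i (pderiv i (dirDeriv y.ofLp (dirDeriv y.ofLp f)))).IsHomogeneous 0 :=
      (isHomogeneous_dirDeriv (isHomogeneous_dirDeriv hf y.ofLp) y.ofLp).pderiv.pderiv
    rw [← totalDegree_zero_iff_isHomogeneous, totalDegree_eq_zero_iff_eq_C] at h3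
    rw [quartForm, dirDeriv_single, dirDeriv_single, h3]
    simp
  have h3 := sum_quartForm_single_le hn hf hμ hM hy
  have h4 := hμ u y hu hy
  rw [eval_kernelInv _ hu, Finset.sum_range_succ, Finset.sum_range_one, invCoeff_zero, one_mul,
    pow_zero, Module.End.one_apply, pow_one, ← hessianBiformAt_eq_eval, h2]
  have h5 : invCoeff n 1 r 1 = -(1 / (2 * (n + 2 * (r + 1)))) := by
    simp only [invCoeff, Finset.prod_range_one, pow_one, Nat.factorial_one]
    rw [show r + 2 * 1 - 1 = r + 1 by omega]
    push_cast
    field_simp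
    ring
  rw [h5]
  have h6 : (0 : ℝ) < n + 2 * (r + 1) := by positivity
  have h7 : 1 / (2 * (n + 2 * (r + 1)) : ℝ)
      * ∑ i, quartForm f (Pi.single i 1) (Pi.single i 1) y.ofLp y.ofLp ≤ μ := by
    rw [one_div, inv_mul_le_iff₀ (by positivity)]
    linarith
  linarith

/-! ### Quartics: flattening the fourth derivatives -/

/-- The bilinear form on matrices obtained by flattening the fourth derivatives. -/
def flattening {n : ℕ} (f : MvPolynomial (Fin n) ℝ) (z w : Fin n → Fin n → ℝ) : ℝ :=
  ∑ i, ∑ k, ∑ j, ∑ l, quartForm f (Pi.single i 1) (Pi.single j 1) (Pi.single k 1) (Pi.single l 1)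
    * z i k * w j l

theorem quartForm_eq_sum {n : ℕ} (f : MvPolynomial (Fin n) ℝ) (a b c d : Fin n → ℝ) :
    quartForm f a b c d = flattening f (fun i k => a i * c k) (fun j l => b j * d l) := by
  simp only [flattening, quartForm, dirDeriv_single]
  have h : ∀ p : MvPolynomial (Fin n) ℝ, ∀ v, dirDeriv v p = ∑ i, v i • pderiv i p :=
    fun p v => dirDeriv_apply v p
  rw [dirDeriv_comm b c]
  simp only [h, map_sum, Derivation.map_smul, smul_eval, Finset.smul_sum]
  refine Finset.sum_congr rfl fun i _ => Finset.sum_congr rfl fun k _ =>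
    Finset.sum_congr rfl fun j _ => Finset.sum_congr rfl fun l _ => ?_
  rw [pderiv_pderiv_comm k j]
  ring

theorem flattening_transpose_left {n : ℕ} (f : MvPolynomial (Fin n) ℝ) (z w : Fin n → Fin n → ℝ) :
    flattening f (fun i k => z k i) w = flattening f z w := by
  unfold flattening
  rw [Finset.sum_comm]
  refine Finset.sum_congr rfl fun i _ => Finset.sum_congr rfl fun k _ =>
    Finset.sum_congr rfl fun j _ => Finset.sum_congr rfl fun l _ => ?_
  simp only [quartForm, dirDeriv_single]
  rw [pderiv_pderiv_comm k j, pderiv_pderiv_comm k i, pderiv_pderiv_comm j i]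

theorem flattening_comm {n : ℕ} (f : MvPolynomial (Fin n) ℝ) (z w : Fin n → Fin n → ℝ) :
    flattening f z w = flattening f w z := by
  unfold flattening
  calc _ = ∑ i, ∑ j, ∑ k, ∑ l, quartForm f (Pi.single i 1) (Pi.single j 1) (Pi.single k 1)
        (Pi.single l 1) * z i k * w j l := Finset.sum_congr rfl fun i _ => Finset.sum_comm
    _ = ∑ j, ∑ i, ∑ k, ∑ l, quartForm f (Pi.single i 1) (Pi.single j 1) (Pi.single k 1)
        (Pi.single l 1) * z i k * w j l := Finset.sum_comm
    _ = ∑ j, ∑ i, ∑ l, ∑ k, quartForm f (Pi.single i 1) (Pi.single j 1) (Pi.single k 1)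
        (Pi.single l 1) * z i k * w j l := Finset.sum_congr rfl fun i _ =>
          Finset.sum_congr rfl fun j _ => Finset.sum_comm
    _ = ∑ j, ∑ l, ∑ i, ∑ k, quartForm f (Pi.single i 1) (Pi.single j 1) (Pi.single k 1)
        (Pi.single l 1) * z i k * w j l := Finset.sum_congr rfl fun i _ => Finset.sum_comm
    _ = _ := by
      refine Finset.sum_congr rfl fun j _ => Finset.sum_congr rfl fun l _ =>
        Finset.sum_congr rfl fun i _ => Finset.sum_congr rfl fun k _ => ?_
      simp only [quartForm, dirDeriv_single]
      rw [pderiv_pderiv_comm i j, pderiv_pderiv_comm k l]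
      ring

theorem flattening_add_left {n : ℕ} (f : MvPolynomial (Fin n) ℝ) (z z' w : Fin n → Fin n → ℝ) :
    flattening f (z + z') w = flattening f z w + flattening f z' w := by
  simp [flattening, mul_add, add_mul, Finset.sum_add_distrib]

theorem flattening_smul_left {n : ℕ} (f : MvPolynomial (Fin n) ℝ) (c : ℝ)
    (z w : Fin n → Fin n → ℝ) : flattening f (c • z) w = c * flattening f z w := by
  simp only [flattening, Finset.mul_sum, Pi.smul_apply, smul_eq_mul]
  refine Finset.sum_congr rfl fun i _ => Finset.sum_congr rfl fun k _ =>
    Finset.sum_congr rfl fun j _ => Finset.sum_congr rfl fun l _ => ?_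
  ring

/-- The flattening as a linear function of its left argument. -/
def flatteningLeft {n : ℕ} (f : MvPolynomial (Fin n) ℝ) (w : Fin n → Fin n → ℝ) :
    (Fin n → Fin n → ℝ) →ₗ[ℝ] ℝ where
  toFun z := flattening f z w
  map_add' z z' := flattening_add_left f z z' w
  map_smul' c z := flattening_smul_left f c z w

theorem flattening_sum_sum {n : ℕ} (f : MvPolynomial (Fin n) ℝ) {ι : Type*} [Fintype ι] (α : ι → ℝ)
    (a : ι → Fin n → Fin n → ℝ) : flattening f (∑ s, α s • a s) (∑ s, α s • a s)
      = ∑ s, ∑ t, α s * α t * flattening f (a s) (a t) := by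
  have h : ∀ w, flattening f (∑ s, α s • a s) w = ∑ s, α s * flattening f (a s) w := by
    intro w
    have h1 := map_sum (flatteningLeft f w) (fun s => α s • a s) Finset.univ
    simp only [map_smul, smul_eq_mul] at h1
    exact h1
  rw [h]
  refine Finset.sum_congr rfl fun s _ => ?_
  rw [flattening_comm, h, Finset.mul_sum]
  refine Finset.sum_congr rfl fun t _ => ?_
  rw [flattening_comm]
  ring

/-- Only the symmetric part of `z` matters, and the spectral theorem writes it as a combination of
rank-one matrices on an orthonormal basis. -/
theorem flattening_self_nonneg {n : ℕ} {f : MvPolynomial (Fin n) ℝ} (hf : f.IsHomogeneous 4)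
    (horth : ∀ b : OrthonormalBasis (Fin n) ℝ (EuclideanSpace ℝ (Fin n)), ∀ α : Fin n → ℝ,
      0 ≤ ∑ s, ∑ t, α s * α t * hessianBiformAt f (b s) (b t)) (z : Fin n → Fin n → ℝ) :
    0 ≤ flattening f z z := by
  set S : Matrix (Fin n) (Fin n) ℝ := Matrix.of (z + fun i k => z k i) with hS
  have hSs : S.IsHermitian := by
    ext i k
    simp [hS, add_comm]
  let b := hSs.eigenvectorBasis
  let α := hSs.eigenvalues
  have hspec : (z + fun i k => z k i) = ∑ s, α s • fun i k => (b s) i * (b s) k := by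
    have h := hSs.spectral_theorem
    funext i k
    have h1 := congrFun (congrFun h i) k
    have h2 : S i k = (z + fun i k => z k i) i k := rfl
    rw [← h2, h1]
    simp only [Unitary.conjStarAlgAut_apply, Matrix.mul_apply, Finset.sum_apply, Pi.smul_apply,
      smul_eq_mul]
    refine Finset.sum_congr rfl fun s _ => ?_
    simp [Matrix.diagonal_apply, b, α, Matrix.IsHermitian.eigenvectorUnitary_apply]
    ring
  have h4 : flattening f (z + fun i k => z k i) (z + fun i k => z k i) = 4 * flattening f z z := by
    have h1 : ∀ w, flattening f (z + fun i k => z k i) w = 2 * flattening f z w := fun w => by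
      rw [flattening_add_left, flattening_transpose_left]
      ring
    rw [h1, flattening_comm, h1]
    ring
  have h5 : 0 ≤ flattening f (z + fun i k => z k i) (z + fun i k => z k i) := by
    rw [hspec, flattening_sum_sum]
    have h6 : ∀ s t, flattening f (fun i k => (b s) i * (b s) k) (fun i k => (b t) i * (b t) k)
        = 2 * hessianBiformAt f (b s) (b t) := by
      intro s t
      rw [← quartForm_self hf, ← quartForm_eq_sum]
      simp only [quartForm]
      rw [dirDeriv_comm (b t).ofLp (b s).ofLp]
    simp only [h6]
    have := horth b α
    refine (mul_nonneg (by norm_num : (0 : ℝ) ≤ 2) this).trans_eq ?_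
    rw [Finset.mul_sum]
    refine Finset.sum_congr rfl fun s _ => ?_
    rw [Finset.mul_sum]
    exact Finset.sum_congr rfl fun t _ => by ring
  linarith

/-- The Hessian form is half the flattening at the matrix x yᵀ, so a positive semidefinite
flattening makes it a sum of squares of bilinear forms. -/
theorem isRSosConvex_quartic_of_orthonormal {n r : ℕ} {f : MvPolynomial (Fin n) ℝ}
    (hf : f.IsHomogeneous 4)
    (horth : ∀ b : OrthonormalBasis (Fin n) ℝ (EuclideanSpace ℝ (Fin n)), ∀ α : Fin n → ℝ,
      0 ≤ ∑ s, ∑ t, α s * α t * hessianBiformAt f (b s) (b t)) : IsRSosConvex r f := by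
  refine IsRSosConvex.of_zero ?_ r
  let G : Fin n × Fin n → Fin n × Fin n → ℝ := fun p q => 1 / 2 *
    quartForm f (Pi.single p.1 1) (Pi.single q.1 1) (Pi.single p.2 1) (Pi.single q.2 1)
  have hflat : ∀ z : Fin n × Fin n → ℝ, ∑ p, ∑ q, G p q * z p * z q
      = 1 / 2 * flattening f (fun i k => z (i, k)) (fun i k => z (i, k)) := by
    intro z
    simp only [Fintype.sum_prod_type, flattening, Finset.mul_sum, G, mul_assoc]
  have hsos := isSumSq_of_psd (σ := Fin n ⊕ Fin n) G (fun p q => by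
      simp only [G, quartForm, dirDeriv_single]
      rw [pderiv_pderiv_comm p.1 q.1, pderiv_pderiv_comm p.2 q.2])
    (fun z => by
      rw [hflat]
      have := flattening_self_nonneg hf horth fun i k => z (i, k)
      positivity) fun p => X (Sum.inl p.1) * X (Sum.inr p.2)
  suffices hh : hessianBiform f = ∑ p, ∑ q, C (G p q) * (X (Sum.inl p.1) * X (Sum.inr p.2))
      * (X (Sum.inl q.1) * X (Sum.inr q.2)) by
    unfold IsRSosConvex
    rw [pow_zero, mul_one, hh]
    exact hsos
  refine MvPolynomial.funext fun v => ?_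
  obtain ⟨x, y, rfl⟩ : ∃ x y, v = Sum.elim x y :=
    ⟨v ∘ Sum.inl, v ∘ Sum.inr, (Sum.elim_comp_inl_inr v).symm⟩
  have h1 := quartForm_self hf (WithLp.toLp 2 x) (WithLp.toLp 2 y)
  have h2 := hflat fun p => x p.1 * y p.2
  rw [← quartForm_eq_sum] at h2
  simp only [hessianBiformAt] at h1
  simp only [map_sum, map_mul, eval_C, eval_X, Sum.elim_inl, Sum.elim_inr]
  rw [h2, h1]
  ring

theorem isRSosConvex_binary_quartic {r : ℕ} {f : MvPolynomial (Fin 2) ℝ} (hf : f.IsHomogeneous 4)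
    (hpos : ∀ x y : EuclideanSpace ℝ (Fin 2), ‖x‖ = 1 → ‖y‖ = 1 → 0 ≤ hessianBiformAt f x y) :
    IsRSosConvex r f := by
  refine isRSosConvex_quartic_of_orthonormal hf fun b α => ?_
  have hnn : ∀ x y, 0 ≤ hessianBiformAt f x y := fun x y => by
    simpa using hessianBiformAt_ge (e := 1) (by norm_num) hf hpos x y
  have hsymm : hessianBiformAt f (b 1) (b 0) = hessianBiformAt f (b 0) (b 1) := by
    have h1 := quartForm_self hf (b 1) (b 0)
    have h2 := quartForm_self hf (b 0) (b 1)
    simp only [quartForm, dirDeriv_comm (b 1).ofLp (b 0).ofLp] at h1 h2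
    linarith
  simp only [Fin.sum_univ_two, hsymm]
  have h00 := hnn (b 0) (b 0)
  have h11 := hnn (b 1) (b 1)
  have h01 := hnn (b 0) (b 1)
  rcases le_total 0 (α 0 * α 1) with h | h
  · have := mul_nonneg h h01
    nlinarith [mul_nonneg (mul_self_nonneg (α 0)) h00, mul_nonneg (mul_self_nonneg (α 1)) h11]
  -- For opposite signs the quadratic expression is itself a value of the Hessian form.
  · have h2 := hnn (√|α 0| • b 0 + √|α 1| • b 1) (√|α 0| • b 0 - √|α 1| • b 1)
    rw [hessianBiformAt_add_sub hf, hessianBiformAt_smul_smul (e := 2) hf,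
      hessianBiformAt_smul_smul (e := 2) hf, hessianBiformAt_smul_smul (e := 2) hf,
      Real.sq_sqrt (abs_nonneg _), Real.sq_sqrt (abs_nonneg _), abs_mul_abs_self, abs_mul_abs_self,
      ← abs_mul, abs_of_nonpos h] at h2
    linarith

/-- Diagonal dominance: `orthonormal_bound` keeps off-diagonal entries below 1.1μ and diagonal ones
above 2.9μ. -/
theorem isRSosConvex_ternary_quartic {r : ℕ} {f : MvPolynomial (Fin 3) ℝ} (hf : f.IsHomogeneous 4)
    {μ M : ℝ} (hμ0 : 0 < μ)
    (hμ : ∀ x y : EuclideanSpace ℝ (Fin 3), ‖x‖ = 1 → ‖y‖ = 1 → μ ≤ hessianBiformAt f x y)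
    (hM : ∀ x y : EuclideanSpace ℝ (Fin 3), ‖x‖ = 1 → ‖y‖ = 1 → hessianBiformAt f x y ≤ M)
    (hμM : M ≤ 3.1 * μ) : IsRSosConvex r f := by
  refine isRSosConvex_quartic_of_orthonormal hf fun b α => ?_
  have hb : ∀ s, ‖b s‖ = 1 := b.orthonormal.1
  have hoff : ∀ s t, s ≠ t → μ ≤ hessianBiformAt f (b s) (b t)
      ∧ hessianBiformAt f (b s) (b t) ≤ 1.1 * μ := fun s t hst => by
    have h1 := orthonormal_bound (by norm_num) hf hμ (hb s) (hb t) (b.orthonormal.2 hst)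
    have h2 := hM _ _ (hb s) (hb s)
    have h3 := hM _ _ (hb t) (hb t)
    exact ⟨hμ _ _ (hb s) (hb t), by linarith⟩
  have hdiag : ∀ s t, s ≠ t → 2.9 * μ ≤ hessianBiformAt f (b s) (b s) := fun s t hst => by
    have h1 := orthonormal_bound (by norm_num) hf hμ (hb s) (hb t) (b.orthonormal.2 hst)
    have h2 := (hoff s t hst).1
    have h3 := hM _ _ (hb t) (hb t)
    linarith
  have hcross : ∀ s t, s ≠ t → -(1.1 * μ * ((α s ^ 2 + α t ^ 2) / 2))
      ≤ α s * α t * hessianBiformAt f (b s) (b t) := fun s t hst => by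
    obtain ⟨h1, h2⟩ := hoff s t hst
    have h3 : |α s * α t| ≤ (α s ^ 2 + α t ^ 2) / 2 := by
      rw [abs_le]
      constructor <;> nlinarith [sq_nonneg (α s + α t), sq_nonneg (α s - α t)]
    have h4 : |α s * α t * hessianBiformAt f (b s) (b t)|
        ≤ (α s ^ 2 + α t ^ 2) / 2 * (1.1 * μ) := by
      rw [abs_mul, abs_of_pos (hμ0.trans_le h1)]
      exact mul_le_mul h3 h2 (hμ0.trans_le h1).le (by positivity)
    linarith [(abs_le.1 h4).1]
  have hsq : ∀ s t, s ≠ t → α s ^ 2 * (2.9 * μ) ≤ α s * α s * hessianBiformAt f (b s) (b s) :=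
    fun s t hst => by
      rw [← pow_two]
      exact mul_le_mul_of_nonneg_left (hdiag s t hst) (sq_nonneg _)
  simp only [Fin.sum_univ_three]
  have e0 := hsq 0 1 (by decide)
  have e1 := hsq 1 0 (by decide)
  have e2 := hsq 2 0 (by decide)
  have c1 := hcross 0 1 (by decide)
  have c2 := hcross 0 2 (by decide)
  have c3 := hcross 1 0 (by decide)
  have c4 := hcross 1 2 (by decide)
  have c5 := hcross 2 0 (by decide)
  have c6 := hcross 2 1 (by decide)
  have q0 := mul_nonneg (sq_nonneg (α 0)) hμ0.le
  have q1 := mul_nonneg (sq_nonneg (α 1)) hμ0.le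
  have q2 := mul_nonneg (sq_nonneg (α 2)) hμ0.le
  nlinarith

/-- The Laplacian bound suffices once 0.44nM + 2(n-1)μ ≥ 8μ. With M ≥ 3μ this holds for n ≥ 4 and
narrowly fails for n = 3, where it needs M ≥ (4/1.32)μ; the cutoff 3.1 lies just above that. -/
theorem isRSosConvex_quartic {n r : ℕ} (hn : 2 ≤ n) {f : MvPolynomial (Fin n) ℝ}
    (hf : f.IsHomogeneous 4) {μ M : ℝ} (hμ0 : 0 < μ)
    (hμ : ∀ x y : EuclideanSpace ℝ (Fin n), ‖x‖ = 1 → ‖y‖ = 1 → μ ≤ hessianBiformAt f x y)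
    (hM : ∀ x y : EuclideanSpace ℝ (Fin n), ‖x‖ = 1 → ‖y‖ = 1 → hessianBiformAt f x y ≤ M)
    (hr : n / Real.log 2 * (M / μ) - 8 ≤ n + 2 * (r + 1)) : IsRSosConvex r f := by
  have hn' : (2 : ℝ) ≤ n := by exact_mod_cast hn
  have hMμ := mul_le_of_bisphere_bounds (k := 1) hn hf hμ hM
  have hl0 : 0 < Real.log 2 := Real.log_pos (by norm_num)
  have hl : (1.44 : ℝ) ≤ 1 / Real.log 2 := by
    rw [le_div_iff₀ hl0]
    linarith [Real.log_two_lt_d9]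
  have hr2 : n * M * 1.44 - 8 * μ ≤ (n + 2 * (r + 1)) * μ := by
    have h1 := mul_le_mul_of_nonneg_right hr hμ0.le
    have h2 : (n / Real.log 2 * (M / μ) - 8) * μ = n * M * (1 / Real.log 2) - 8 * μ := by
      field_simp
    have h3 : n * M * (1.44 : ℝ) ≤ n * M * (1 / Real.log 2) := by
      refine mul_le_mul_of_nonneg_left hl (mul_nonneg (by linarith) ?_)
      norm_num at hMμ
      linarith
    linarith
  norm_num at hMμ
  rcases lt_or_ge n 4 with h4 | h4
  · interval_cases n
    · exact isRSosConvex_binary_quartic hf fun x y hx hy => hμ0.le.trans (hμ x y hx hy)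
    · rcases le_total M (3.1 * μ) with h | h
      · exact isRSosConvex_ternary_quartic hf hμ0 hμ hM h
      · refine isRSosConvex_quartic_of_le (by norm_num) hf hμ hM ?_
        push_cast at hr2 ⊢
        linarith
  · refine isRSosConvex_quartic_of_le (by omega) hf hμ hM ?_
    have h5 : (4 : ℝ) ≤ n := by exact_mod_cast h4
    have h6 : n * (3 * μ) ≤ n * M := mul_le_mul_of_nonneg_left hMμ (by linarith)
    have h7 : 4 * μ ≤ n * μ := mul_le_mul_of_nonneg_right h5 hμ0.le
    nlinarith

end

/-! ### Assembling the cases -/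

theorem mainTheorem5 (n d : ℕ) (hn : 1 ≤ n) (f : MvPolynomial (Fin n) ℝ)
    (hf : f.IsHomogeneous d)
    (hpos : ∀ x ∈ Metric.sphere (0 : EuclideanSpace ℝ (Fin n)) 1,
      ∀ y ∈ Metric.sphere (0 : EuclideanSpace ℝ (Fin n)) 1, 0 < hessianBiformAt f x y)
    (r : ℕ)
    (hr : (r : ℝ) ≥ (n : ℝ) * ((d : ℝ) - 2) * ((d : ℝ) - 3) / (4 * Real.log 2 * bisphereRatio f)
      - ((n : ℝ) + (d : ℝ) - 2) / 2 - (d : ℝ)) :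
    IsRSosConvex r f := by
  have hpos' : ∀ x y : EuclideanSpace ℝ (Fin n), ‖x‖ = 1 → ‖y‖ = 1 → 0 < hessianBiformAt f x y :=
    fun x y hx hy => hpos x (by simpa using hx) y (by simpa using hy)
  set e : EuclideanSpace ℝ (Fin n) := EuclideanSpace.single ⟨0, hn⟩ 1 with he
  have he1 : ‖e‖ = 1 := by simp [he]
  have hhess : (dirDeriv e.ofLp (dirDeriv e.ofLp f)).IsHomogeneous (d - 2) :=
    isHomogeneous_dirDeriv (isHomogeneous_dirDeriv hf _) _
  have hee := hpos' e e he1 he1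
  have hd : 2 ≤ d := by
    by_contra! hd
    have h0 : dirDeriv e.ofLp (dirDeriv e.ofLp f) = 0 := by
      have h1 := isHomogeneous_dirDeriv hf e.ofLp
      rw [show d - 1 = 0 by omega] at h1
      rw [dirDeriv_apply e.ofLp (dirDeriv e.ofLp f)]
      exact Finset.sum_eq_zero fun i _ => by
        rw [pderiv_eq_zero_of_isHomogeneous_zero h1, smul_zero]
    rw [hessianBiformAt_eq_eval, h0, map_zero] at hee
    exact hee.false
  obtain ⟨k, rfl⟩ : ∃ k, d = 2 * k + 2 := by
    rcases Nat.even_or_odd (d - 2) with ⟨k, hk⟩ | ⟨k, hk⟩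
    · exact ⟨k, by omega⟩
    -- In odd degree, `x ↦ -x` would reverse the sign of the Hessian form.
    · have h1 := hessianBiformAt_smul_smul (e := d - 2) (by rwa [Nat.sub_add_cancel hd]) (-1) 1 e e
      rw [Odd.neg_one_pow ⟨k, hk⟩] at h1
      have h2 := hpos' ((-1 : ℝ) • e) ((1 : ℝ) • e) (by simp [he1]) (by simp [he1])
      linarith
  set μ := sInf (bisphereValues f) with hμdef
  set M := sSup (bisphereValues f) with hMdef
  have hμ : ∀ x y : EuclideanSpace ℝ (Fin n), ‖x‖ = 1 → ‖y‖ = 1 → μ ≤ hessianBiformAt f x y :=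
    fun x y hx hy => (isLeast_bisphereValues hn f).2
      ⟨x, by simpa using hx, y, by simpa using hy, rfl⟩
  have hM : ∀ x y : EuclideanSpace ℝ (Fin n), ‖x‖ = 1 → ‖y‖ = 1 → hessianBiformAt f x y ≤ M :=
    fun x y hx hy => (isGreatest_bisphereValues hn f).2
      ⟨x, by simpa using hx, y, by simpa using hy, rfl⟩
  have hμ0 : 0 < μ := by
    obtain ⟨x, hx, y, hy, hxy⟩ := (isLeast_bisphereValues hn f).1
    rw [← hμdef] at hxy
    rw [← hxy]
    exact hpos x hx y hy
  -- One variable is separate: the bound on M/μ needs a direction orthogonal to `x`.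
  rcases Nat.eq_or_lt_of_le hn with rfl | hn2
  · exact isRSosConvex_of_univariate hf fun x y hx hy => (hpos' x y hx hy).le
  have hM0 : 0 < M := hee.trans_le (hM e e he1 he1)
  have hl0 : 0 < Real.log 2 := Real.log_pos (by norm_num)
  have hconv : (n : ℝ) * (((2 * k + 2 : ℕ) : ℝ) - 2) * (((2 * k + 2 : ℕ) : ℝ) - 3)
      / (4 * Real.log 2 * bisphereRatio f)
      = n * (2 * k) * (2 * k - 1) / (4 * Real.log 2) * (M / μ) := by
    rw [bisphereRatio, ← hμdef, ← hMdef]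
    push_cast
    field_simp
    ring
  rw [hconv] at hr
  push_cast at hr
  rcases k with _ | _ | k
  · exact isRSosConvex_of_quadratic hn hf fun x y hx hy => (hpos' x y hx hy).le
  · refine isRSosConvex_quartic hn2 hf hμ0 hμ hM ?_
    have h1 : (n : ℝ) * (2 * ((0 + 1 : ℕ) : ℝ)) * (2 * ((0 + 1 : ℕ) : ℝ) - 1) / (4 * Real.log 2)
        * (M / μ) = n / Real.log 2 * (M / μ) / 2 := by
      push_cast
      field_simp
      norm_num
    rw [h1] at hr
    push_cast at hr
    linarith
  · refine isRSosConvex_of_two_le hn2 (by omega) hf hμ0 hμ hM ?_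
    linarith
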